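/- Let $n\ge 1$. There is an integer $K=K(n)$ with the following property. Let $U_1,\dots,U_{n+1}\subset\mathbb R^n$ be bounded open sets, let $V_i\supset\overline{U_i}$ be open sets, and let $A\in\mathbb R$ and $\lambda,\nu,\epsilon>0$. Then there is a constant $C$, depending only on $n,\epsilon,\nu,\lambda,A$ and the sets $U_i,V_i$, such that the following holds. Let $\Sigma_i: V_i\to\mathbb R^{n+1}$ ($1\le i\le n+1$) be smooth maps such that (i) all derivatives of $\Sigma_i$ of order at most $K$ (including $\Sigma_i$ itself) are bounded by $A$ on $V_i$, where the derivative of order $k$ is measured in the operator norm of $k$-linear maps; (ii) $\Sigma_i$ is uniformly an immersion on $U_i$: $|d\Sigma_i(\xi)v|\ge\lambda|v|$ for all $\xi\in U_i$, $v\in\mathbb R^n$; (iii) the hypersurfaces are transversal: $|\det(N_1,\dots,N_{n+1})|\ge\nu$ for all choices of $\xi_i\in U_i$ and of unit vectors $N_i\in\mathbb R^{n+1}$ orthogonal to the range of $d\Sigma_i(\xi_i)$, i.e. of unit normals to the hypersurfaces at $\Sigma_i(\xi_i)$. Let $\mathcal E_i f(x)=\int_{U_i}e^{i x\cdot\Sigma_i(\xi)}f(\xi)\,d\xi$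 for $x\in\mathbb R^{n+1}$. Then for every $R\ge 1$ and all $f_i\in L^2(U_i)$, $1\le i\le n+1$, $$\Big\|\prod_{i=1}^{n+1}\mathcal E_i f_i\Big\|_{L^{2/n}(B(0,R))}\le C\,R^{\epsilon}\prod_{i=1}^{n+1}\|f_i\|_{L^2(U_i)},$$ where $B(0,R)\subset\mathbb R^{n+1}$ is the ball of radius $R$ centred at the origin and $\|F\|_{L^{2/n}}=\big(\int|F|^{2/n}\big)^{n/2}$ (a quasi-norm for $n>2$). -/

import Mathlib

open MeasureTheory Set
open scoped ENNReal NNReal ContDiff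

/-- The extension operator of a parametrized hypersurface `S : U → ℝⁿ⁺¹`, `U ⊆ ℝⁿ`:
`ℰ f (x) = ∫_U exp (i x · S ξ) f ξ dξ`. -/
noncomputable def extensionOp {n : ℕ} (U : Set (EuclideanSpace ℝ (Fin n)))
    (S : EuclideanSpace ℝ (Fin n) → EuclideanSpace ℝ (Fin (n + 1)))
    (f : EuclideanSpace ℝ (Fin n) → ℂ) (x : EuclideanSpace ℝ (Fin (n + 1))) : ℂ :=
  ∫ ξ in U, Complex.exp (Complex.I * ((inner ℝ x (S ξ) : ℝ) : ℂ)) * f ξ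

/-- `N` is a unit normal to the hypersurface parametrized by `S` at the point with parameter `ξ`:
a unit vector orthogonal to the tangent space, the range of the differential of `S` at `ξ`. -/
def IsUnitNormal {n : ℕ} (S : EuclideanSpace ℝ (Fin n) → EuclideanSpace ℝ (Fin (n + 1)))
    (ξ : EuclideanSpace ℝ (Fin n)) (N : EuclideanSpace ℝ (Fin (n + 1))) : Prop :=
  ‖N‖ = 1 ∧ ∀ v : EuclideanSpace ℝ (Fin n), inner ℝ (fderiv ℝ S ξ v) N = 0

/-- Transversality with constant `ν`: `|det (N₁, …, Nₙ₊₁)| ≥ ν` for all choices of a point on each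
hypersurface and of a unit normal there. -/
def TransversalWith {n : ℕ} (U : Fin (n + 1) → Set (EuclideanSpace ℝ (Fin n)))
    (S : Fin (n + 1) → EuclideanSpace ℝ (Fin n) → EuclideanSpace ℝ (Fin (n + 1)))
    (ν : ℝ) : Prop :=
  ∀ (ξ : Fin (n + 1) → EuclideanSpace ℝ (Fin n))
    (N : Fin (n + 1) → EuclideanSpace ℝ (Fin (n + 1))),
    (∀ i, ξ i ∈ U i) → (∀ i, IsUnitNormal (S i) (ξ i) (N i)) →
      ν ≤ |Matrix.det (Matrix.of fun i j => N i j)|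

set_option linter.unusedSectionVars false

section DiscreteInequalities

theorem ENNReal.tsum_mul_rpow_le {α : Type*} (f g : α → ℝ≥0∞) {p q : ℝ} (hp : 0 ≤ p) (hq : 0 ≤ q)
    (hpq : p + q = 1) :
    ∑' a, f a ^ p * g a ^ q ≤ (∑' a, f a) ^ p * (∑' a, g a) ^ q := by
  let _ : MeasurableSpace α := ⊤
  simp only [← lintegral_count]
  exact ENNReal.lintegral_mul_norm_pow_le measurable_from_top.aemeasurable
    measurable_from_top.aemeasurable hp hq hpq

theorem ENNReal.tsum_prod_rpow_le {α ι : Type*} [Fintype ι] (f : ι → α → ℝ≥0∞) {p : ℝ}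
    (hp : 0 ≤ p) (hp1 : Fintype.card ι * p = 1) :
    ∑' a, ∏ i, f i a ^ p ≤ ∏ i, (∑' a, f i a) ^ p := by
  let _ : MeasurableSpace α := ⊤
  simp only [← lintegral_count]
  exact ENNReal.lintegral_prod_norm_pow_le Finset.univ
    (fun i _ => measurable_from_top.aemeasurable) (by simpa using hp1) (fun _ _ => hp)

theorem tsum_fin_succ {n : ℕ} {α : Type*} (f : (Fin (n + 1) → α) → ℝ≥0∞) :
    ∑' k, f k = ∑' t, ∑' k : Fin n → α, f (Fin.cons t k) := by
  rw [← ENNReal.tsum_prod (f := fun t k => f (Fin.cons t k)),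
    ← (Fin.consEquiv (fun _ : Fin (n + 1) => α)).tsum_eq]
  rfl

/-- The discrete Loomis–Whitney inequality. -/
theorem tsum_prod_succAbove_le {α : Type*} (n : ℕ)
    (a : Fin (n + 2) → (Fin (n + 1) → α) → ℝ≥0∞) :
    ∑' k : Fin (n + 2) → α, ∏ i, a i (k ∘ i.succAbove) ^ (1 / ((n + 1 : ℕ) : ℝ)) ≤
      ∏ i, (∑' m, a i m) ^ (1 / ((n + 1 : ℕ) : ℝ)) := by
  induction n with
  | zero =>
    have h0 : ∀ (t : α) (k : Fin 1 → α), (Fin.cons t k : Fin 2 → α) ∘ (0 : Fin 2).succAbove = k := by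
      intro t k; ext j; fin_cases j; rfl
    have h1 : ∀ (t : α) (k : Fin 1 → α),
        (Fin.cons t k : Fin 2 → α) ∘ (1 : Fin 2).succAbove = fun _ => t := by
      intro t k; ext j; fin_cases j; rfl
    have key : ∑' k : Fin 2 → α, ∏ i : Fin 2, a i (k ∘ i.succAbove) ≤
        ∏ i : Fin 2, ∑' m, a i m := by
      rw [tsum_fin_succ]
      simp only [Fin.prod_univ_two, h0, h1]
      simp only [ENNReal.tsum_mul_right, ENNReal.tsum_mul_left]
      rw [← (Equiv.funUnique (Fin 1) α).symm.tsum_eq (a 1)]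
      exact le_of_eq rfl
    simpa using key
  | succ n ih =>
    set p : ℝ := 1 / ((n + 1 + 1 : ℕ) : ℝ) with hp
    set q : ℝ := ((n + 1 : ℕ) : ℝ) / ((n + 1 + 1 : ℕ) : ℝ) with hq
    have hpp : 0 ≤ p := by positivity
    have hqp : 0 ≤ q := by positivity
    have hpq : p + q = 1 := by rw [hp, hq]; push_cast; field_simp; ring
    have hr : 1 / ((n + 1 : ℕ) : ℝ) * q = p := by rw [hp, hq]; push_cast; field_simp
    have h0 : ∀ (t : α) (k : Fin (n + 2) → α),
        (Fin.cons t k : Fin (n + 3) → α) ∘ (0 : Fin (n + 3)).succAbove = k := by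
      intro t k; ext j; simp
    have h1 : ∀ (t : α) (k : Fin (n + 2) → α) (i : Fin (n + 2)),
        (Fin.cons t k : Fin (n + 3) → α) ∘ i.succ.succAbove = Fin.cons t (k ∘ i.succAbove) := by
      intro t k i; ext j
      refine Fin.cases ?_ (fun j => ?_) j <;> simp
    set G : Fin (n + 2) → α → ℝ≥0∞ := fun j t => ∑' m, a j.succ (Fin.cons t m) with hG
    rw [tsum_fin_succ, Fin.prod_univ_succ]
    simp only [Fin.prod_univ_succ (n := n + 2), h0, h1]
    calc _ ≤ ∑' t, (∑' m, a 0 m) ^ p * ∏ j, G j t ^ p := by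
          refine ENNReal.tsum_le_tsum fun t => ?_
          calc _ = ∑' k : Fin (n + 2) → α, a 0 k ^ p *
                (∏ j : Fin (n + 2), a j.succ (Fin.cons t (k ∘ j.succAbove)) ^
                  (1 / ((n + 1 : ℕ) : ℝ))) ^ q := by
                refine tsum_congr fun k => ?_
                rw [← ENNReal.prod_rpow_of_nonneg hqp]
                simp only [← ENNReal.rpow_mul, hr]
            _ ≤ (∑' m, a 0 m) ^ p * (∑' k : Fin (n + 2) → α, ∏ j : Fin (n + 2),
                  a j.succ (Fin.cons t (k ∘ j.succAbove)) ^ (1 / ((n + 1 : ℕ) : ℝ))) ^ q :=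
                ENNReal.tsum_mul_rpow_le _ _ hpp hqp hpq
            _ ≤ (∑' m, a 0 m) ^ p * (∏ j, G j t ^ (1 / ((n + 1 : ℕ) : ℝ))) ^ q := by
                gcongr
                exact ih fun j m => a j.succ (Fin.cons t m)
            _ = _ := by
                rw [← ENNReal.prod_rpow_of_nonneg hqp]
                simp only [← ENNReal.rpow_mul, hr]
      _ = (∑' m, a 0 m) ^ p * ∑' t, ∏ j, G j t ^ p := ENNReal.tsum_mul_left
      _ ≤ (∑' m, a 0 m) ^ p * ∏ j, (∑' t, G j t) ^ p := by
          gcongr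
          refine ENNReal.tsum_prod_rpow_le G hpp ?_
          rw [Fintype.card_fin, hp]; field_simp
      _ = _ := by
          simp only [hG, tsum_fin_succ (fun m => a _ m)]

theorem tsum_pi_prod {n : ℕ} {α : Type*} (f : Fin n → α → ℝ≥0∞) :
    ∑' m : Fin n → α, ∏ j, f j (m j) = ∏ j, ∑' t, f j t := by
  induction n with
  | zero => simp
  | succ n ih =>
    rw [tsum_fin_succ, Fin.prod_univ_succ]
    simp only [Fin.prod_univ_succ (n := n), Fin.cons_zero, Fin.cons_succ, ENNReal.tsum_mul_left,
      ih fun j => f j.succ, ENNReal.tsum_mul_right]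

theorem exists_tsum_int_inv_one_add_sq_le :
    ∃ C : ℝ≥0, ∀ a : ℝ, ∑' m : ℤ, ENNReal.ofReal (1 / (1 + (m + a) ^ 2)) ≤ C := by
  have hs : Summable fun m : ℤ => 3 * (1 / (1 + (m : ℝ) ^ 2)) := by
    have h1 : Summable fun m : ℤ => 1 / (m : ℝ) ^ 2 :=
      Real.summable_one_div_int_pow.mpr one_lt_two
    refine Summable.mul_left _ ((h1.add (summable_of_hasFiniteSupport
      (f := fun m : ℤ => if m = 0 then (1 : ℝ) else 0)
      ((finite_singleton (0 : ℤ)).subset fun m hm => by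
        by_contra h; simp at h; simp [h] at hm))).of_nonneg_of_le (fun m => by positivity)
      fun m => ?_)
    by_cases hm : m = 0
    · simp [hm]
    · have : (0 : ℝ) < (m : ℝ) ^ 2 := by positivity
      simp only [hm, if_false, add_zero]
      gcongr
      linarith
  refine ⟨(∑' m : ℤ, 3 * (1 / (1 + (m : ℝ) ^ 2))).toNNReal, fun a => ?_⟩
  rw [← (Equiv.subRight ⌊a⌋).tsum_eq]
  refine (ENNReal.tsum_le_tsum (g := fun m : ℤ => ENNReal.ofReal (3 * (1 / (1 + (m : ℝ) ^ 2))))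
    fun m => ENNReal.ofReal_le_ofReal ?_).trans ?_
  · have h1 := Int.floor_le a
    have h2 := Int.lt_floor_add_one a
    simp only [Equiv.subRight_apply, Int.cast_sub]
    rw [mul_one_div, div_le_div_iff₀ (by positivity) (by positivity)]
    obtain ⟨f, hfa⟩ : ∃ f : ℝ, f = a - ⌊a⌋ := ⟨_, rfl⟩
    have hf : (m : ℝ) - ⌊a⌋ + a = m + f := by rw [hfa]; ring
    have hf0 : 0 ≤ f := by linarith
    have hf1 : f ≤ 1 := by linarith
    rw [hf]
    nlinarith [sq_nonneg (m + 2 * f), sq_nonneg ((m : ℝ) + f), mul_nonneg hf0 (sub_nonneg.2 hf1)]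
  · rw [← ENNReal.ofReal_tsum_of_nonneg (fun m => by positivity) hs]
    rfl

end DiscreteInequalities

section DirectionalResolvent

open FourierTransform SchwartzMap

variable {E : Type*} [NormedAddCommGroup E] [InnerProductSpace ℝ E] [FiniteDimensional ℝ E]
  [MeasurableSpace E] [BorelSpace E]

/-- A smooth positive weight whose square is integrable. -/
noncomputable def decayWeight (η : E) : ℝ := ((1 + ‖η‖ ^ 2) ^ (Module.finrank ℝ E + 1))⁻¹

theorem decayWeight_pos (η : E) : 0 < decayWeight η := by unfold decayWeight; positivity

theorem decayWeight_le_one (η : E) : decayWeight η ≤ 1 := by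
  unfold decayWeight
  exact inv_le_one_of_one_le₀ (one_le_pow₀ (by nlinarith [sq_nonneg ‖η‖]))

theorem contDiff_decayWeight : ContDiff ℝ ∞ (decayWeight : E → ℝ) := by
  unfold decayWeight
  exact ContDiff.inv ((contDiff_const.add (contDiff_norm_sq ℝ)).pow _) fun η => by positivity

theorem memLp_decayWeight : MemLp (decayWeight : E → ℝ) 2 volume := by
  have hc : Continuous (decayWeight : E → ℝ) := contDiff_decayWeight.continuous
  rw [memLp_two_iff_integrable_sq hc.aestronglyMeasurable]
  have h1 : Integrable (fun η : E => (1 + ‖η‖ ^ 2) ^ (-(2 * (Module.finrank ℝ E + 1 : ℕ) : ℝ) / 2)) :=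
    integrable_rpow_neg_one_add_norm_sq (by push_cast; linarith)
  refine h1.mono' (hc.pow 2).aestronglyMeasurable (Filter.Eventually.of_forall fun η => ?_)
  have h2 : (1 + ‖η‖ ^ 2) ^ (-(2 * (Module.finrank ℝ E + 1 : ℕ) : ℝ) / 2) = decayWeight η := by
    rw [show (-(2 * (Module.finrank ℝ E + 1 : ℕ) : ℝ) / 2) = -((Module.finrank ℝ E + 1 : ℕ) : ℝ) by
      ring, Real.rpow_neg (by positivity), Real.rpow_natCast]
    rfl
  rw [h2, Real.norm_of_nonneg (by positivity)]
  nlinarith [decayWeight_pos η, decayWeight_le_one η]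

/-- The Fourier symbol of the resolvent `(1 + i t - ∂_u)⁻¹`. -/
noncomputable def resolventSymbol (u : E) (t : ℝ) (w : E) : ℂ :=
  (1 + Complex.I * ((t - 2 * Real.pi * inner ℝ w u : ℝ) : ℂ))⁻¹

theorem norm_resolventSymbol_sq (u : E) (t : ℝ) (w : E) :
    ‖resolventSymbol u t w‖ ^ 2 = 1 / (1 + (t - 2 * Real.pi * inner ℝ w u) ^ 2) := by
  rw [resolventSymbol, norm_inv, inv_pow, one_div, ← Complex.normSq_eq_norm_sq]
  congr 1
  simp only [Complex.normSq_apply, Complex.add_re, Complex.add_im, Complex.mul_re, Complex.mul_im,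
    Complex.I_re, Complex.I_im, Complex.ofReal_re, Complex.ofReal_im, Complex.one_re,
    Complex.one_im]
  ring

theorem norm_resolventSymbol_le (u : E) (t : ℝ) (w : E) : ‖resolventSymbol u t w‖ ≤ 1 := by
  refine (sq_le_one_iff₀ (norm_nonneg _)).1 ?_
  rw [norm_resolventSymbol_sq, div_le_one (by positivity)]
  nlinarith [sq_nonneg (t - 2 * Real.pi * inner ℝ w u)]

theorem one_add_I_mul_ne_zero (x : ℝ) : (1 + Complex.I * (x : ℂ)) ≠ 0 := by
  intro h
  have := congrArg Complex.re h
  simp at this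

theorem hasTemperateGrowth_resolventSymbol (u : E) (t : ℝ) :
    (resolventSymbol u t).HasTemperateGrowth := by
  have h1 : (fun x : ℝ => (1 + ‖x‖ ^ 2) ^ (-1 : ℝ)).HasTemperateGrowth :=
    Function.hasTemperateGrowth_one_add_norm_sq_rpow ℝ (-1)
  have h2 : (fun x : ℝ => (1 - Complex.I * (x : ℂ)) *
      (((1 + ‖x‖ ^ 2) ^ (-1 : ℝ) : ℝ) : ℂ)).HasTemperateGrowth := by
    refine Function.HasTemperateGrowth.mul ?_ ?_
    · exact (Function.HasTemperateGrowth.const 1).sub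
        ((Function.HasTemperateGrowth.const _).mul Function.Complex.hasTemperateGrowth_ofReal)
    · exact Function.Complex.hasTemperateGrowth_ofReal.comp h1
  have h3 : (fun w : E => t - 2 * Real.pi * inner ℝ w u).HasTemperateGrowth := by
    exact (Function.HasTemperateGrowth.const t).sub
      ((Function.HasTemperateGrowth.const (2 * Real.pi)).mul
        (Function.hasTemperateGrowth_inner_left u))
  convert h2.comp h3 using 1
  ext w
  simp only [Function.comp, resolventSymbol]
  set x : ℝ := t - 2 * Real.pi * inner ℝ w u
  rw [Real.rpow_neg_one, Complex.ofReal_inv, inv_eq_iff_eq_inv, mul_inv, inv_inv, eq_inv_mul_iff_mul_eq₀]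
  · rw [Real.norm_eq_abs, sq_abs]
    push_cast
    linear_combination (-(x : ℂ) ^ 2) * Complex.I_sq
  · simpa [sub_eq_add_neg] using one_add_I_mul_ne_zero (-x)

theorem memLp_resolventSymbol (u : E) (t : ℝ) : MemLp (resolventSymbol u t) ∞ volume :=
  memLp_top_of_bound (hasTemperateGrowth_resolventSymbol u t).1.continuous.aestronglyMeasurable 1
    (Filter.Eventually.of_forall (norm_resolventSymbol_le u t))

/-- The resolvent `(1 + i t - ∂_u)⁻¹` on `L²`. -/
noncomputable def dirResolvent (u : E) (t : ℝ) : Lp ℂ 2 (volume : Measure E) →L[ℂ] Lp ℂ 2 (volume : Measure E) :=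
  ((Lp.fourierTransformₗᵢ E ℂ).symm : Lp ℂ 2 (volume : Measure E) →L[ℂ] Lp ℂ 2 (volume : Measure E)) ∘L
    ((ContinuousLinearMap.mul ℂ ℂ).holderL volume ∞ 2 2 (memLp_resolventSymbol u t).toLp) ∘L
    (Lp.fourierTransformₗᵢ E ℂ : Lp ℂ 2 (volume : Measure E) →L[ℂ] Lp ℂ 2 (volume : Measure E))

theorem fourier_dirResolvent (u : E) (t : ℝ) (F : Lp ℂ 2 (volume : Measure E)) :
    ⇑(𝓕 (dirResolvent u t F) : Lp ℂ 2 (volume : Measure E)) =ᵐ[volume] fun w => resolventSymbol u t w * (𝓕 F : Lp ℂ 2 (volume : Measure E)) w := by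
  have h1 : 𝓕 (dirResolvent u t F) = (ContinuousLinearMap.mul ℂ ℂ).holder 2
      (memLp_resolventSymbol u t).toLp (𝓕 F) :=
    (Lp.fourierTransformₗᵢ E ℂ).apply_symm_apply _
  rw [h1]
  filter_upwards [ContinuousLinearMap.coeFn_holder (r := 2) (ContinuousLinearMap.mul ℂ ℂ)
    (memLp_resolventSymbol u t).toLp (𝓕 F), (memLp_resolventSymbol u t).coeFn_toLp] with w h1 h2
  rw [h1, h2]
  rfl

theorem dirResolvent_toLp (u : E) (t : ℝ) (f : 𝓢(E, ℂ)) :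
    dirResolvent u t (f.toLp 2) = (fourierMultiplierCLM ℂ (resolventSymbol u t) f).toLp 2 := by
  have h0 : Function.Injective (𝓕 : Lp ℂ 2 (volume : Measure E) → Lp ℂ 2 (volume : Measure E)) :=
    (Lp.fourierTransformₗᵢ E ℂ).injective
  apply h0
  rw [SchwartzMap.toLp_fourier_eq, fourierMultiplierCLM_apply,
    FourierTransform.fourier_fourierInv_eq]
  refine Lp.ext ?_
  filter_upwards [fourier_dirResolvent u t (f.toLp 2), (𝓕 f).coeFn_toLp 2,
    (smulLeftCLM ℂ (resolventSymbol u t) (𝓕 f)).coeFn_toLp 2] with w h1 h2 h3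
  rw [h1, h3, SchwartzMap.toLp_fourier_eq, h2,
    smulLeftCLM_apply_apply (hasTemperateGrowth_resolventSymbol u t)]
  rfl

open LineDeriv in
theorem eq_sub_lineDeriv_multiplier (u : E) (t : ℝ) (f : 𝓢(E, ℂ)) :
    f = (1 + Complex.I * t) • fourierMultiplierCLM ℂ (resolventSymbol u t) f -
      ∂_{u} (fourierMultiplierCLM ℂ (resolventSymbol u t) f) := by
  have h0 : Function.Injective (𝓕 : 𝓢(E, ℂ) → 𝓢(E, ℂ)) := (fourierEquiv ℂ 𝓢(E, ℂ)).injective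
  apply h0
  have h1 : 𝓕 (fourierMultiplierCLM ℂ (resolventSymbol u t) f) =
      smulLeftCLM ℂ (resolventSymbol u t) (𝓕 f) := by
    rw [fourierMultiplierCLM_apply, FourierTransform.fourier_fourierInv_eq]
  rw [sub_eq_add_neg, FourierTransform.fourier_add, FourierTransform.fourier_neg,
    FourierTransform.fourier_smul, fourier_lineDerivOp_eq, h1]
  ext w
  simp only [add_apply, neg_apply, smul_apply, smulLeftCLM_apply_apply
    (hasTemperateGrowth_resolventSymbol u t),
    smulLeftCLM_apply_apply (Function.hasTemperateGrowth_inner_left u), smul_eq_mul,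
    Complex.real_smul]
  have h2 : (1 + Complex.I * ((t - 2 * Real.pi * inner ℝ w u : ℝ) : ℂ)) *
      resolventSymbol u t w = 1 := mul_inv_cancel₀ (one_add_I_mul_ne_zero _)
  push_cast at h2
  linear_combination (-(𝓕 f) w) * h2

theorem memLp_of_le_decayWeight {θ : E → ℂ} (hθ : Continuous θ) {C : ℝ}
    (hC : ∀ η, ‖θ η‖ ≤ C * decayWeight η) : MemLp θ 2 volume :=
  (memLp_decayWeight.const_mul C).mono' hθ.aestronglyMeasurable (Filter.Eventually.of_forall hC)

/-- Integration by parts against the resolvent. -/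
theorem integral_mul_eq_integral_mul_dirResolvent (u : E) (t : ℝ) {θ : E → ℂ}
    (hθ : ContDiff ℝ ∞ θ) {C : ℝ} (hC : ∀ η, ‖θ η‖ ≤ C * decayWeight η)
    (hC' : ∀ η, ‖fderiv ℝ θ η u‖ ≤ C * decayWeight η) (F : Lp ℂ 2 (volume : Measure E)) :
    ∫ η, θ η * F η =
      ∫ η, ((1 + Complex.I * t) * θ η + fderiv ℝ θ η u) * (dirResolvent u t F : Lp ℂ 2 (volume : Measure E)) η := by
  have hc' : Continuous fun η => fderiv ℝ θ η u :=
    (hθ.continuous_fderiv (by simp)).clm_apply continuous_const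
  have m1 : MemLp θ 2 volume := memLp_of_le_decayWeight hθ.continuous hC
  have m2 : MemLp (fun η => fderiv ℝ θ η u) 2 volume := memLp_of_le_decayWeight hc' hC'
  have m3 : MemLp (fun η => (1 + Complex.I * t) * θ η + fderiv ℝ θ η u) 2 volume :=
    (m1.const_mul _).add m2
  have pair : ∀ {φ : E → ℂ} (hφ : MemLp φ 2 volume) (G : Lp ℂ 2 (volume : Measure E)),
      ∫ η, φ η * G η = (ContinuousLinearMap.mul ℂ ℂ).lpPairing volume 2 2 hφ.toLp G := by
    intro φ hφ G
    rw [ContinuousLinearMap.lpPairing_eq_integral]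
    refine integral_congr_ae ?_
    filter_upwards [hφ.coeFn_toLp] with η h
    simp [h]
  rw [pair m1, pair m3]
  refine DenseRange.induction_on (p := fun F => (ContinuousLinearMap.mul ℂ ℂ).lpPairing volume 2 2
    m1.toLp F = (ContinuousLinearMap.mul ℂ ℂ).lpPairing volume 2 2 m3.toLp (dirResolvent u t F))
    (SchwartzMap.denseRange_toLpCLM (p := 2) (F := ℂ) (μ := (volume : Measure E))
      ENNReal.ofNat_ne_top) F ?_ ?_
  · exact isClosed_eq (ContinuousLinearMap.continuous _)
      ((ContinuousLinearMap.continuous _).comp (ContinuousLinearMap.continuous _))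
  intro f
  rw [← pair m1, ← pair m3, SchwartzMap.toLpCLM_apply, dirResolvent_toLp]
  set H := fourierMultiplierCLM ℂ (resolventSymbol u t) f with hH
  have mH : MemLp H 2 volume := H.memLp 2
  have mH' : MemLp (LineDeriv.lineDerivOp u H : 𝓢(E, ℂ)) 2 (volume : Measure E) :=
    SchwartzMap.memLp _ 2 volume
  have hH' : ∀ η, (LineDeriv.lineDerivOp u H : 𝓢(E, ℂ)) η = fderiv ℝ H η u := fun η => by
    rw [SchwartzMap.lineDerivOp_apply_eq_fderiv]
  have e1 : ∫ η, θ η * (f.toLp 2 : Lp ℂ 2 (volume : Measure E)) η =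
      ∫ η, ((1 + Complex.I * t) * (θ η * H η) - θ η * fderiv ℝ H η u) := by
    refine integral_congr_ae ?_
    filter_upwards [f.coeFn_toLp 2] with η h
    rw [h]
    conv_lhs => rw [eq_sub_lineDeriv_multiplier u t f, ← hH]
    simp only [_root_.sub_apply, _root_.smul_apply, smul_eq_mul, hH']
    ring
  have e2 : ∫ η, ((1 + Complex.I * t) * θ η + fderiv ℝ θ η u) * (H.toLp 2 : Lp ℂ 2 (volume : Measure E)) η =
      ∫ η, ((1 + Complex.I * t) * (θ η * H η) + fderiv ℝ θ η u * H η) := by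
    refine integral_congr_ae ?_
    filter_upwards [H.coeFn_toLp 2] with η h
    rw [h]
    ring
  have i1 : Integrable fun η => θ η * H η := MemLp.integrable_mul m1 mH
  have i2 : Integrable fun η => θ η * fderiv ℝ H η u := by
    simp only [← hH']
    exact MemLp.integrable_mul m1 mH'
  have i3 : Integrable fun η => fderiv ℝ θ η u * H η := MemLp.integrable_mul m2 mH
  rw [e1, e2, integral_sub (i1.const_mul _) i2, integral_add (i1.const_mul _) i3,
    integral_mul_fderiv_eq_neg_fderiv_mul_of_integrable i3 i2 i1
      (fun η _ => (hθ.differentiable (by simp)) η) (fun η _ => H.differentiableAt)]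
  ring

/-- Composition of the resolvents in the directions `u j`, `j ∈ l`. -/
noncomputable def dirResolventList {ι : Type*} (u : ι → E) (t : ι → ℝ) :
    List ι → Lp ℂ 2 (volume : Measure E) → Lp ℂ 2 (volume : Measure E)
  | [], F => F
  | j :: l, F => dirResolventList u t l (dirResolvent (u j) (t j) F)

theorem fourier_dirResolventList {ι : Type*} (u : ι → E) (t : ι → ℝ) (l : List ι)
    (F : Lp ℂ 2 (volume : Measure E)) :
    ⇑(𝓕 (dirResolventList u t l F) : Lp ℂ 2 (volume : Measure E)) =ᵐ[volume]
      fun w => (l.map fun j => resolventSymbol (u j) (t j) w).prod * (𝓕 F : Lp ℂ 2 (volume : Measure E)) w := by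
  induction l generalizing F with
  | nil => simp [dirResolventList]
  | cons j l ih =>
    filter_upwards [ih (dirResolvent (u j) (t j) F), fourier_dirResolvent (u j) (t j) F]
      with w h1 h2
    rw [dirResolventList, h1, h2, List.map_cons, List.prod_cons]
    ring

theorem enorm_Lp_two_sq (F : Lp ℂ 2 (volume : Measure E)) : ‖F‖ₑ ^ 2 = ∫⁻ η, ‖F η‖ₑ ^ 2 := by
  rw [Lp.enorm_def, eLpNorm_eq_lintegral_rpow_enorm_toReal two_ne_zero ENNReal.ofNat_ne_top]
  simp only [ENNReal.toReal_ofNat, ENNReal.rpow_ofNat]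
  rw [← ENNReal.rpow_natCast, ← ENNReal.rpow_mul]
  simp

/-- Almost orthogonality of the pieces of `F` localized to the cells of a lattice. -/
theorem exists_tsum_dirResolventList_le (n : ℕ) :
    ∃ C : ℝ≥0, ∀ (u : Fin n → E) (F : Lp ℂ 2 (volume : Measure E)),
      ∑' m : Fin n → ℤ, ‖dirResolventList u (fun j => -(m j : ℝ)) (List.finRange n) F‖ₑ ^ 2 ≤
        C * ‖F‖ₑ ^ 2 := by
  obtain ⟨C, hC⟩ := exists_tsum_int_inv_one_add_sq_le
  refine ⟨C ^ n, fun u F => ?_⟩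
  have key : ∀ m : Fin n → ℤ,
      ‖dirResolventList u (fun j => -(m j : ℝ)) (List.finRange n) F‖ₑ ^ 2 =
      ∫⁻ w, (∏ j, ENNReal.ofReal (1 / (1 + (m j + 2 * Real.pi * inner ℝ w (u j)) ^ 2))) *
        ‖(𝓕 F : Lp ℂ 2 (volume : Measure E)) w‖ₑ ^ 2 := by
    intro m
    have h0 : ‖dirResolventList u (fun j => -(m j : ℝ)) (List.finRange n) F‖ₑ =
        ‖𝓕 (dirResolventList u (fun j => -(m j : ℝ)) (List.finRange n) F)‖ₑ := by
      rw [← ofReal_norm, ← ofReal_norm, Lp.norm_fourier_eq]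
    rw [h0, enorm_Lp_two_sq]
    refine lintegral_congr_ae ?_
    filter_upwards [fourier_dirResolventList u (fun j => -(m j : ℝ)) (List.finRange n) F] with w h
    rw [h, enorm_mul, mul_pow]
    congr 1
    rw [← List.ofFn_eq_map, List.prod_ofFn, ← ofReal_norm, norm_prod,
      ENNReal.ofReal_prod_of_nonneg (fun _ _ => norm_nonneg _), ← Finset.prod_pow]
    refine Finset.prod_congr rfl fun j _ => ?_
    rw [← ENNReal.ofReal_pow (norm_nonneg _), norm_resolventSymbol_sq]
    congr 3
    ring
  have hF : AEMeasurable (fun w => ‖(𝓕 F : Lp ℂ 2 (volume : Measure E)) w‖ₑ ^ 2) volume :=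
    (Lp.aestronglyMeasurable _).enorm.pow_const 2
  have hm : ∀ m : Fin n → ℤ, Measurable fun w : E =>
      ∏ j, ENNReal.ofReal (1 / (1 + (m j + 2 * Real.pi * inner ℝ w (u j)) ^ 2)) := fun m =>
    Finset.measurable_prod _ fun j _ => by fun_prop
  simp only [key]
  rw [← lintegral_tsum (f := fun (m : Fin n → ℤ) (w : E) =>
    (∏ j, ENNReal.ofReal (1 / (1 + (m j + 2 * Real.pi * inner ℝ w (u j)) ^ 2))) *
      ‖(𝓕 F : Lp ℂ 2 (volume : Measure E)) w‖ₑ ^ 2) fun m => (hm m).aemeasurable.mul hF]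
  calc _ ≤ ∫⁻ w, (C : ℝ≥0∞) ^ n * ‖(𝓕 F : Lp ℂ 2 (volume : Measure E)) w‖ₑ ^ 2 := by
        refine lintegral_mono fun w => ?_
        simp only
        rw [ENNReal.tsum_mul_right, tsum_pi_prod fun j (z : ℤ) =>
          ENNReal.ofReal (1 / (1 + (z + 2 * Real.pi * inner ℝ w (u j)) ^ 2))]
        gcongr
        refine (Finset.prod_le_pow_card _ _ (C : ℝ≥0∞) fun j _ => hC _).trans ?_
        simp
    _ = _ := by
        rw [lintegral_const_mul'' _ hF, ← enorm_Lp_two_sq, ← ofReal_norm,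
          Lp.norm_fourier_eq, ofReal_norm, ENNReal.coe_pow]

end DirectionalResolvent

section DirectionalBounds

variable {E : Type*} [NormedAddCommGroup E] [NormedSpace ℝ E] {ι : Type*}

/-- `f` and its iterated derivatives of order at most `k` in the directions `u j` are bounded
by `M`. -/
def DirBound {G : Type*} [NormedAddCommGroup G] [NormedSpace ℝ G] (u : ι → E) :
    ℕ → ℝ → (E → G) → Prop
  | 0, M, f => ∀ η, ‖f η‖ ≤ M
  | k + 1, M, f => (∀ η, ‖f η‖ ≤ M) ∧ ∀ j, DirBound u k M fun η => fderiv ℝ f η (u j)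

variable {G : Type*} [NormedAddCommGroup G] [NormedSpace ℝ G] {u : ι → E} {k : ℕ} {M M' : ℝ}

theorem DirBound.norm_le {f : E → G} (h : DirBound u k M f) (η : E) : ‖f η‖ ≤ M := by
  cases k with
  | zero => exact h η
  | succ k => exact h.1 η

theorem DirBound.mono_const {f : E → G} (h : DirBound u k M f) (hM : M ≤ M') :
    DirBound u k M' f := by
  induction k generalizing f with
  | zero => exact fun η => (h η).trans hM
  | succ k ih => exact ⟨fun η => (h.1 η).trans hM, fun j => ih (h.2 j)⟩

theorem DirBound.of_succ {f : E → G} (h : DirBound u (k + 1) M f) : DirBound u k M f := by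
  induction k generalizing f with
  | zero => exact h.1
  | succ k ih => exact ⟨h.1, fun j => ih (h.2 j)⟩

theorem DirBound.of_le {k' : ℕ} {f : E → G} (h : DirBound u k M f) (hk : k' ≤ k) :
    DirBound u k' M f := by
  induction hk with
  | refl => exact h
  | step _ ih => exact ih h.of_succ

theorem DirBound.const {c : G} (hc : ‖c‖ ≤ M) (k : ℕ) : DirBound u k M fun _ : E => c := by
  have hM : 0 ≤ M := (norm_nonneg c).trans hc
  induction k generalizing c with
  | zero => exact fun _ => hc
  | succ k ih =>
    refine ⟨fun _ => hc, fun j => ?_⟩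
    simpa using ih (c := 0) (by simpa using hM)

theorem ContDiff.fderiv_dir {f : E → G} (hf : ContDiff ℝ ∞ f) (v : E) :
    ContDiff ℝ ∞ fun η => fderiv ℝ f η v :=
  (hf.fderiv_right (m := ∞) (by simp)).clm_apply contDiff_const

theorem DirBound.add {f g : E → G} (hf : ContDiff ℝ ∞ f) (hg : ContDiff ℝ ∞ g)
    (h : DirBound u k M f) (h' : DirBound u k M' g) :
    DirBound u k (M + M') fun η => f η + g η := by
  induction k generalizing f g with
  | zero => exact fun η => (norm_add_le _ _).trans (add_le_add (h η) (h' η))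
  | succ k ih =>
    refine ⟨fun η => (norm_add_le _ _).trans (add_le_add (h.1 η) (h'.1 η)), fun j => ?_⟩
    convert ih (hf.fderiv_dir (u j)) (hg.fderiv_dir (u j)) (h.2 j) (h'.2 j) using 2 with η
    rw [fderiv_fun_add (hf.differentiable (by simp) η) (hg.differentiable (by simp) η)]
    rfl

theorem DirBound.mul {A : Type*} [NormedRing A] [NormedAlgebra ℝ A] {f g : E → A}
    (hf : ContDiff ℝ ∞ f) (hg : ContDiff ℝ ∞ g)
    (h : DirBound u k M f) (h' : DirBound u k M' g) :
    DirBound u k (2 ^ k * (M * M')) fun η => f η * g η := by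
  have key : ∀ {k : ℕ} {f g : E → A}, DirBound u k M f → DirBound u k M' g →
      ∀ η, ‖f η * g η‖ ≤ M * M' := fun h h' η => (norm_mul_le _ _).trans
    (mul_le_mul (h.norm_le η) (h'.norm_le η) (norm_nonneg _) ((norm_nonneg _).trans (h.norm_le η)))
  induction k generalizing f g with
  | zero => exact fun η => by simpa using key h h' η
  | succ k ih =>
    refine ⟨fun η => (key h h' η).trans ?_, fun j => ?_⟩
    · exact le_mul_of_one_le_left ((norm_nonneg _).trans (key h h' η)) (one_le_pow₀ one_le_two)
    · have h1 := (ih (hf.fderiv_dir (u j)) hg (h.2 j) h'.of_succ).add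
        ((hf.fderiv_dir (u j)).mul hg) (hf.mul (hg.fderiv_dir (u j)))
        (ih hf (hg.fderiv_dir (u j)) h.of_succ (h'.2 j))
      convert h1 using 1
      · ring
      · ext η
        rw [fderiv_fun_mul' (hf.differentiable (by simp) η) (hg.differentiable (by simp) η)]
        simp [add_comm]

theorem DirBound.smul_dir {f : E → G} (h : DirBound u k M f) (hf : ContDiff ℝ ∞ f) {r : ℝ}
    (hr : |r| ≤ 1) : DirBound (fun j => r • u j) k M f := by
  have hs0 : ∀ x : G, ‖r • x‖ ≤ ‖x‖ := fun x => by
    rw [norm_smul, Real.norm_eq_abs]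
    exact mul_le_of_le_one_left (norm_nonneg _) hr
  have hs : ∀ {k : ℕ} {f : E → G} (_ : ContDiff ℝ ∞ f), DirBound u k M f →
      DirBound u k M fun η => r • f η := by
    intro k f hf h
    induction k generalizing f with
    | zero => exact fun η => (hs0 _).trans (h η)
    | succ k ih =>
      refine ⟨fun η => (hs0 _).trans (h.1 η), fun j => ?_⟩
      convert ih (hf.fderiv_dir (u j)) (h.2 j) using 2 with η
      rw [fderiv_fun_const_smul (hf.differentiable (by simp) η)]
      rfl
  induction k generalizing f with
  | zero => exact h
  | succ k ih =>
    refine ⟨h.1, fun j => ?_⟩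
    simp only [map_smul]
    exact ih (hs (hf.fderiv_dir (u j)) (h.2 j)) ((hf.fderiv_dir (u j)).const_smul r)

theorem DirBound.const_smul {f : E → G} (h : DirBound u k M f) (hf : ContDiff ℝ ∞ f) (r : ℝ) :
    DirBound u k (|r| * M) fun η => r • f η := by
  have key : ∀ {k : ℕ} {f : E → G}, DirBound u k M f → ∀ η, ‖r • f η‖ ≤ |r| * M := fun h η => by
    rw [norm_smul, Real.norm_eq_abs]
    exact mul_le_mul_of_nonneg_left (h.norm_le η) (abs_nonneg _)
  induction k generalizing f with
  | zero => exact key h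
  | succ k ih =>
    refine ⟨key h, fun j => ?_⟩
    convert ih (h.2 j) (hf.fderiv_dir (u j)) using 2 with η
    rw [fderiv_fun_const_smul (hf.differentiable (by simp) η)]
    rfl

/-- Rescaling the directions makes the derivatives of a bounded function as small as its values. -/
theorem DirBound.rescale {f : E → G} {B c r : ℝ} (h : DirBound u k B f) (hf : ContDiff ℝ ∞ f)
    (hc : ∀ η, ‖f η‖ ≤ c) (hr : 0 ≤ r) (hr1 : r ≤ 1) (hrB : r * B ≤ c) :
    DirBound (fun j => r • u j) k c f := by
  cases k with
  | zero => exact hc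
  | succ k =>
    refine ⟨hc, fun j => ?_⟩
    have h1 := ((h.2 j).const_smul (hf.fderiv_dir (u j)) r).smul_dir
      ((hf.fderiv_dir (u j)).const_smul r) (r := r) (by rwa [abs_of_nonneg hr])
    rw [abs_of_nonneg hr] at h1
    simp only [map_smul]
    exact h1.mono_const hrB

theorem DirBound.ofReal {f : E → ℝ} (hf : ContDiff ℝ ∞ f) (h : DirBound u k M f) :
    DirBound u k M fun η => (f η : ℂ) := by
  have hd : ∀ {f : E → ℝ} (_ : ContDiff ℝ ∞ f) (η v : E),
      fderiv ℝ (fun η => (f η : ℂ)) η v = (fderiv ℝ f η v : ℂ) := fun hf η v => by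
    have h1 := (Complex.ofRealCLM.hasFDerivAt).comp η (hf.differentiable (by simp) η).hasFDerivAt
    exact congrArg (fun L : E →L[ℝ] ℂ => L v) h1.fderiv
  induction k generalizing f with
  | zero => exact fun η => by simpa using h η
  | succ k ih =>
    refine ⟨fun η => by simpa using h.1 η, fun j => ?_⟩
    simp only [hd hf]
    exact ih (hf.fderiv_dir (u j)) (h.2 j)

end DirectionalBounds

section Oscillatory

variable {E : Type*} [NormedAddCommGroup E] [InnerProductSpace ℝ E]

/-- The logarithmic derivative of `decayWeight` in the direction `u`. -/
noncomputable def weightLogDeriv (u : E) (η : E) : ℝ :=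
  -(2 * (Module.finrank ℝ E + 1)) * (inner ℝ η u * (1 + ‖η‖ ^ 2)⁻¹)

theorem hasFDerivAt_one_add_norm_sq (η : E) :
    HasFDerivAt (fun η : E => 1 + ‖η‖ ^ 2) ((2 : ℝ) • innerSL ℝ η) η := by
  have h := (hasStrictFDerivAt_norm_sq η).hasFDerivAt.const_add 1
  rwa [two_nsmul, ← two_smul ℝ] at h

theorem contDiff_inv_one_add_norm_sq : ContDiff ℝ ∞ fun η : E => (1 + ‖η‖ ^ 2)⁻¹ :=
  (contDiff_const.add (contDiff_norm_sq ℝ)).inv fun η => by positivity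

theorem fderiv_inv_one_add_norm_sq (η v : E) :
    fderiv ℝ (fun η : E => (1 + ‖η‖ ^ 2)⁻¹) η v =
      -2 * (inner ℝ η v * (1 + ‖η‖ ^ 2)⁻¹ * (1 + ‖η‖ ^ 2)⁻¹) := by
  have h := (hasDerivAt_inv (x := 1 + ‖η‖ ^ 2) (by positivity)).comp_hasFDerivAt η
    (hasFDerivAt_one_add_norm_sq η)
  rw [show (fun η : E => (1 + ‖η‖ ^ 2)⁻¹) = Inv.inv ∘ fun η : E => 1 + ‖η‖ ^ 2 from rfl, h.fderiv]
  simp only [_root_.smul_apply, innerSL_apply_apply, smul_eq_mul]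
  rw [sq (1 + ‖η‖ ^ 2), mul_inv]
  ring

theorem contDiff_weightLogDeriv (u : E) : ContDiff ℝ ∞ (weightLogDeriv u) :=
  contDiff_const.mul ((contDiff_id.inner ℝ contDiff_const).mul contDiff_inv_one_add_norm_sq)

theorem fderiv_decayWeight (η v : E) :
    fderiv ℝ (decayWeight : E → ℝ) η v = weightLogDeriv v η * decayWeight η := by
  have hd : HasFDerivAt (fun η : E => (1 + ‖η‖ ^ 2)⁻¹) _ η :=
    ((contDiff_inv_one_add_norm_sq (E := E)).differentiable (by simp) η).hasFDerivAt
  have h := hd.pow (Module.finrank ℝ E + 1)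
  have e : (decayWeight : E → ℝ) = fun η : E => (1 + ‖η‖ ^ 2)⁻¹ ^ (Module.finrank ℝ E + 1) := by
    ext η
    simp [decayWeight]
  rw [e, h.fderiv]
  simp only [_root_.smul_apply, fderiv_inv_one_add_norm_sq,
    weightLogDeriv, smul_eq_mul, nsmul_eq_mul]
  push_cast
  ring

theorem exists_dirBound_weightLogDeriv (ι : Type*) (k : ℕ) (B : ℝ) :
    ∃ M, ∀ v : ι → E, (∀ j, ‖v j‖ ≤ B) →
      ∀ i, DirBound v k M (weightLogDeriv (v i)) := by
  suffices h : ∀ k, ∃ M, ∀ v : ι → E, (∀ j, ‖v j‖ ≤ B) →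
      (DirBound v k M fun η : E => (1 + ‖η‖ ^ 2)⁻¹) ∧
      ∀ i, DirBound v k M fun η : E => inner ℝ η (v i) * (1 + ‖η‖ ^ 2)⁻¹ by
    obtain ⟨M, hM⟩ := h k
    refine ⟨|(-(2 * (Module.finrank ℝ E + 1)) : ℝ)| * M, fun v hv i => ?_⟩
    exact ((hM v hv).2 i).const_smul
      ((contDiff_id.inner ℝ contDiff_const).mul contDiff_inv_one_add_norm_sq) _
  have hg1 : ∀ η : E, ‖(1 + ‖η‖ ^ 2)⁻¹‖ ≤ 1 := fun η => by
    rw [Real.norm_of_nonneg (by positivity)]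
    exact inv_le_one_of_one_le₀ (by nlinarith [sq_nonneg ‖η‖])
  have hp1 : ∀ (v : E), ‖v‖ ≤ B → ∀ η : E, ‖inner ℝ η v * (1 + ‖η‖ ^ 2)⁻¹‖ ≤ B := fun v hv η => by
    rw [norm_mul, norm_inv, Real.norm_of_nonneg (r := 1 + ‖η‖ ^ 2) (by positivity),
      ← div_eq_mul_inv, div_le_iff₀ (by positivity)]
    have h1 := norm_inner_le_norm (𝕜 := ℝ) η v
    have h2 : ‖η‖ ≤ 1 + ‖η‖ ^ 2 := by nlinarith [sq_nonneg (‖η‖ - 1)]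
    have h3 := norm_nonneg v
    have h4 := norm_nonneg η
    nlinarith [mul_le_mul h2 hv h3 (by positivity)]
  intro k
  induction k with
  | zero =>
    exact ⟨max 1 B, fun v hv => ⟨fun η => (hg1 η).trans (le_max_left _ _),
      fun i η => (hp1 _ (hv i) η).trans (le_max_right _ _)⟩⟩
  | succ k ih =>
    obtain ⟨M, hM⟩ := ih
    set M1 := |(-2 : ℝ)| * (2 ^ k * (M * M)) with hM1
    refine ⟨max (max 1 B) (max M1 (B * B * |M| + M1)), fun v hv => ?_⟩
    obtain ⟨hg, hp⟩ := hM v hv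
    have cg : ContDiff ℝ ∞ fun η : E => (1 + ‖η‖ ^ 2)⁻¹ := contDiff_inv_one_add_norm_sq
    have cp : ∀ i, ContDiff ℝ ∞ fun η : E => inner ℝ η (v i) * (1 + ‖η‖ ^ 2)⁻¹ := fun i =>
      (contDiff_id.inner ℝ contDiff_const).mul cg
    refine ⟨⟨fun η => (hg1 η).trans (by simp), fun j => ?_⟩, fun i =>
      ⟨fun η => (hp1 _ (hv i) η).trans (by simp), fun j => ?_⟩⟩
    · simp only [fderiv_inv_one_add_norm_sq]
      exact (((hp j).mul (cp j) cg hg).const_smul ((cp j).mul cg) (-2)).mono_const (by simp [hM1])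
    · have h1 : (fun η => fderiv ℝ (fun η : E => inner ℝ η (v i) * (1 + ‖η‖ ^ 2)⁻¹) η (v j)) =
          fun η => inner ℝ (v j) (v i) • (1 + ‖η‖ ^ 2)⁻¹ + (-2 : ℝ) •
            ((inner ℝ η (v i) * (1 + ‖η‖ ^ 2)⁻¹) * (inner ℝ η (v j) * (1 + ‖η‖ ^ 2)⁻¹)) := by
        ext η
        rw [fderiv_fun_mul (c := fun η : E => inner ℝ η (v i))
          (differentiableAt_id.inner ℝ (differentiableAt_const _)) (cg.differentiable (by simp) η)]
        simp only [_root_.add_apply, _root_.smul_apply, smul_eq_mul,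
          fderiv_inv_one_add_norm_sq]
        rw [show fderiv ℝ (fun y : E => inner ℝ y (v i)) η (v j) = inner ℝ (v j) (v i) by
          rw [fderiv_inner_apply ℝ differentiableAt_fun_id (differentiableAt_const _)]; simp]
        ring
      rw [h1]
      refine ((hg.const_smul cg _).add (cg.const_smul _)
        (((cp i).mul (cp j)).const_smul (-2 : ℝ))
        (((hp i).mul (cp i) (cp j) (hp j)).const_smul ((cp i).mul (cp j)) (-2))).mono_const ?_
      refine le_trans (add_le_add_left ?_ _) ((le_max_right _ _).trans (le_max_right _ _))
      have h2 : |inner ℝ (v j) (v i)| ≤ B * B := (abs_real_inner_le_norm _ _).trans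
        (mul_le_mul (hv j) (hv i) (norm_nonneg _) ((norm_nonneg _).trans (hv j)))
      exact (mul_le_mul_of_nonneg_left (le_abs_self M) (abs_nonneg _)).trans
        (mul_le_mul_of_nonneg_right h2 (abs_nonneg _))

variable [FiniteDimensional ℝ E] [MeasurableSpace E] [BorelSpace E] {σ : Type*} [Fintype σ]

/-- The weighted extension operator with phase `∑ l, s l * Θ η l`. -/
noncomputable def oscOp (Θ : E → σ → ℝ) (F : E → ℂ) (s : σ → ℝ) : ℂ :=
  ∫ η, Complex.exp (Complex.I * ((∑ l, s l * Θ η l : ℝ) : ℂ)) * (decayWeight η : ℂ) * F η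

theorem norm_exp_I_mul_ofReal (x : ℝ) : ‖Complex.exp (Complex.I * (x : ℂ))‖ = 1 := by
  rw [mul_comm, Complex.norm_exp_ofReal_mul_I]

theorem continuous_oscKernel {Θ : E → σ → ℝ} (hΘ : ContDiff ℝ ∞ Θ) (s : σ → ℝ) :
    ContDiff ℝ ∞ fun η => Complex.exp (Complex.I * ((∑ l, s l * Θ η l : ℝ) : ℂ)) *
      (decayWeight η : ℂ) := by
  have h1 : ContDiff ℝ ∞ fun η => ∑ l, s l * Θ η l :=
    ContDiff.sum fun l _ => contDiff_const.mul ((contDiff_pi.1 hΘ) l)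
  exact (contDiff_const.mul (Complex.ofRealCLM.contDiff.comp h1)).cexp.mul
    (Complex.ofRealCLM.contDiff.comp contDiff_decayWeight)

theorem norm_oscKernel (Θ : E → σ → ℝ) (s : σ → ℝ) (η : E) :
    ‖Complex.exp (Complex.I * ((∑ l, s l * Θ η l : ℝ) : ℂ)) * (decayWeight η : ℂ)‖ =
      decayWeight η := by
  rw [norm_mul, norm_exp_I_mul_ofReal, one_mul, Complex.norm_real,
    Real.norm_of_nonneg (decayWeight_pos η).le]

theorem memLp_oscKernel {Θ : E → σ → ℝ} (hΘ : ContDiff ℝ ∞ Θ) (s : σ → ℝ) :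
    MemLp (fun η => Complex.exp (Complex.I * ((∑ l, s l * Θ η l : ℝ) : ℂ)) *
      (decayWeight η : ℂ)) 2 volume :=
  memLp_of_le_decayWeight (C := 1) (continuous_oscKernel hΘ s).continuous fun η => by
    rw [norm_oscKernel, one_mul]

theorem oscOp_add_arg {Θ : E → σ → ℝ} (F : E → ℂ) (s c : σ → ℝ) :
    oscOp Θ F (s + c) =
      oscOp Θ (fun η => Complex.exp (Complex.I * ((∑ l, c l * Θ η l : ℝ) : ℂ)) * F η) s := by
  unfold oscOp
  congr 1
  ext η
  have : (((∑ l, (s + c) l * Θ η l : ℝ) : ℂ)) =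
      ((∑ l, s l * Θ η l : ℝ) : ℂ) + ((∑ l, c l * Θ η l : ℝ) : ℂ) := by
    rw [← Complex.ofReal_add, ← Finset.sum_add_distrib]
    simp [add_mul]
  rw [this, mul_add, Complex.exp_add]
  ring

theorem oscOp_add {Θ : E → σ → ℝ} (hΘ : ContDiff ℝ ∞ Θ) {F G : E → ℂ} (hF : MemLp F 2 volume)
    (hG : MemLp G 2 volume) (s : σ → ℝ) :
    oscOp Θ (fun η => F η + G η) s = oscOp Θ F s + oscOp Θ G s := by
  have h := integral_add (MemLp.integrable_mul (memLp_oscKernel hΘ s) hF)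
    (MemLp.integrable_mul (memLp_oscKernel hΘ s) hG)
  simp only [Pi.mul_apply, ← mul_add] at h
  exact h

theorem oscOp_sum {Θ : E → σ → ℝ} (hΘ : ContDiff ℝ ∞ Θ) {Λ : Type*} [Fintype Λ] (c : Λ → ℂ)
    {F : Λ → E → ℂ} (hF : ∀ i, MemLp (F i) 2 volume) (s : σ → ℝ) :
    oscOp Θ (fun η => ∑ i, c i * F i η) s = ∑ i, c i * oscOp Θ (F i) s := by
  have h := integral_finsetSum Finset.univ fun i _ =>
    (MemLp.integrable_mul (memLp_oscKernel hΘ s) (hF i)).const_mul (c i)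
  simp only [Pi.mul_apply, integral_const_mul] at h
  unfold oscOp
  rw [← h]
  congr 1
  ext η
  rw [Finset.mul_sum]
  exact Finset.sum_congr rfl fun i _ => by ring

theorem exists_norm_oscOp_le (E : Type*) [NormedAddCommGroup E] [InnerProductSpace ℝ E]
    [FiniteDimensional ℝ E] [MeasurableSpace E] [BorelSpace E] :
    ∃ C : ℝ≥0, ∀ {σ : Type} [Fintype σ] (Θ : E → σ → ℝ) (F : E → ℂ) (s : σ → ℝ),
      MemLp F 2 volume → ‖oscOp Θ F s‖ₑ ≤ C * eLpNorm F 2 volume := by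
  have hw : eLpNorm (decayWeight : E → ℝ) 2 volume ≠ ⊤ := memLp_decayWeight.2.ne
  refine ⟨(eLpNorm (decayWeight : E → ℝ) 2 volume).toNNReal, fun Θ F s hF => ?_⟩
  rw [ENNReal.coe_toNNReal hw]
  refine (enorm_integral_le_lintegral_enorm _).trans ?_
  have h1 := eLpNorm_smul_le_mul_eLpNorm (p := 2) (q := 2) (r := 1) hF.1
    (memLp_decayWeight (E := E)).1
  rw [eLpNorm_one_eq_lintegral_enorm] at h1
  refine le_trans (lintegral_mono fun η => ?_) h1
  rw [enorm_mul, ← ofReal_norm, norm_oscKernel, Pi.smul_apply', enorm_smul,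
    ← ofReal_norm (decayWeight η), Real.norm_of_nonneg (decayWeight_pos η).le]

theorem MemLp.bdd_contDiff_mul {b F : E → ℂ} (hb : ContDiff ℝ ∞ b) {M : ℝ} (hM : ∀ η, ‖b η‖ ≤ M)
    (hF : MemLp F 2 volume) : MemLp (fun η => b η * F η) 2 volume :=
  (hF.const_mul (M : ℂ)).mono (hb.continuous.aestronglyMeasurable.mul hF.1)
    (Filter.Eventually.of_forall fun η => by
      rw [norm_mul, norm_mul, Complex.norm_real]
      exact mul_le_mul_of_nonneg_right ((hM η).trans (le_abs_self M)) (norm_nonneg _))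

/-- One integration by parts in the direction `u`: the phase derivative is expanded into
finitely many products of a function of `s` and a function of `η`. -/
theorem norm_oscOp_mul_le {Θ : E → σ → ℝ} (hΘ : ContDiff ℝ ∞ Θ) (u : E) (t : ℝ) {b : E → ℂ}
    (hb : ContDiff ℝ ∞ b) {M K : ℝ} (hM : ∀ η, ‖b η‖ ≤ M) (hM' : ∀ η, ‖fderiv ℝ b η u‖ ≤ M)
    (hK : ∀ η, ‖weightLogDeriv u η‖ ≤ K) (G : Lp ℂ 2 (volume : Measure E)) {s : σ → ℝ}
    {Λ : Type*} [Fintype Λ] {c : Λ → ℂ} {g : Λ → E → ℂ} (hc : ∀ i, ‖c i‖ ≤ 1)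
    (hg : ∀ i, ContDiff ℝ ∞ (g i)) (hg1 : ∀ i η, ‖g i η‖ ≤ 1)
    (h : ∀ η, Complex.I * ((∑ l, s l * fderiv ℝ (fun η => Θ η l) η u + t : ℝ) : ℂ) =
      ∑ i, c i * g i η) :
    ‖oscOp Θ (fun η => b η * G η) s‖ ≤
      ‖oscOp Θ (fun η => (b η + fderiv ℝ b η u + weightLogDeriv u η * b η) *
        (dirResolvent u t G : Lp ℂ 2 (volume : Measure E)) η) s‖ +
      ∑ i, ‖oscOp Θ (fun η => (g i η * b η) *
        (dirResolvent u t G : Lp ℂ 2 (volume : Measure E)) η) s‖ := by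
  have hM0 : 0 ≤ M := (norm_nonneg _).trans (hM 0)
  have hK0 : 0 ≤ K := (norm_nonneg _).trans (hK 0)
  set θ : E → ℂ := fun η => Complex.exp (Complex.I * ((∑ l, s l * Θ η l : ℝ) : ℂ)) *
    (decayWeight η : ℂ) * b η with hθ
  have cθ : ContDiff ℝ ∞ θ := (continuous_oscKernel hΘ s).mul hb
  set D : E → ℝ := fun η => ∑ l, s l * fderiv ℝ (fun η => Θ η l) η u with hD
  have hφ : ∀ η, HasFDerivAt (fun η => ∑ l, s l * Θ η l)
      (∑ l, s l • fderiv ℝ (fun η => Θ η l) η) η := fun η =>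
    HasFDerivAt.fun_sum fun l _ =>
      ((((contDiff_pi.1 hΘ) l).differentiable (by simp) η).hasFDerivAt.const_mul (s l))
  have hdθ : ∀ η, fderiv ℝ θ η u =
      Complex.exp (Complex.I * ((∑ l, s l * Θ η l : ℝ) : ℂ)) * (decayWeight η : ℂ) *
        (Complex.I * (D η : ℂ) * b η + weightLogDeriv u η * b η + fderiv ℝ b η u) := by
    intro η
    have h1 := ((Complex.ofRealCLM.hasFDerivAt.comp η (hφ η)).const_mul Complex.I).cexp
    have h2 := Complex.ofRealCLM.hasFDerivAt.comp η
      ((contDiff_decayWeight (E := E)).differentiable (by simp) η).hasFDerivAt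
    have h3 := (h1.mul h2).mul (hb.differentiable (by simp) η).hasFDerivAt
    have h4 : fderiv ℝ θ η = _ := h3.fderiv
    rw [h4]
    simp only [_root_.add_apply, _root_.smul_apply, smul_eq_mul,
      ContinuousLinearMap.comp_apply, fderiv_decayWeight, Complex.ofRealCLM_apply,
      Function.comp, Pi.mul_apply, _root_.sum_apply, hD]
    push_cast
    ring
  have hDb : ∀ η, ‖(D η : ℂ)‖ ≤ Fintype.card Λ + |t| := by
    intro η
    have h1 : Complex.I * (D η : ℂ) = ∑ i, c i * g i η - Complex.I * t := by
      rw [← h η]; simp only [hD]; push_cast; ring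
    have h2 : ‖(D η : ℂ)‖ = ‖Complex.I * (D η : ℂ)‖ := by simp
    rw [h2, h1]
    refine (norm_sub_le _ _).trans (add_le_add ((norm_sum_le _ _).trans ?_) (by simp))
    refine (Finset.sum_le_card_nsmul _ _ 1 fun i _ => ?_).trans (by simp)
    rw [norm_mul]
    exact mul_le_one₀ (hc i) (norm_nonneg _) (hg1 i η)
  set C : ℝ := M + ((Fintype.card Λ + |t|) * M + K * M + M) with hC
  have b1 : ∀ η, ‖θ η‖ ≤ C * decayWeight η := fun η => by
    rw [hθ, norm_mul, norm_oscKernel, mul_comm]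
    refine mul_le_mul_of_nonneg_right ((hM η).trans ?_) (decayWeight_pos η).le
    rw [hC]
    exact le_add_of_nonneg_right (by positivity)
  have b2 : ∀ η, ‖fderiv ℝ θ η u‖ ≤ C * decayWeight η := fun η => by
    rw [hdθ, norm_mul, norm_oscKernel, mul_comm]
    refine mul_le_mul_of_nonneg_right ?_ (decayWeight_pos η).le
    rw [hC]
    refine le_add_of_nonneg_of_le hM0 ((norm_add₃_le).trans ?_)
    rw [norm_mul, norm_mul, norm_mul, Complex.norm_I, one_mul, Complex.norm_real (weightLogDeriv u η)]
    gcongr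
    · exact hDb η
    · exact hM η
    · exact hK η
    · exact hM η
    · exact hM' η
  have main := integral_mul_eq_integral_mul_dirResolvent u t cθ b1 b2 G
  set W : Lp ℂ 2 (volume : Measure E) := dirResolvent u t G
  have hW : MemLp W 2 volume := Lp.memLp W
  have e0 : oscOp Θ (fun η => b η * G η) s = ∫ η, θ η * G η := by
    unfold oscOp
    congr 1
    ext η
    simp only [hθ]
    ring
  have cκ : ContDiff ℝ ∞ fun η => (weightLogDeriv u η : ℂ) :=
    Complex.ofRealCLM.contDiff.comp (contDiff_weightLogDeriv u)
  have m1 : MemLp (fun η => (b η + fderiv ℝ b η u + weightLogDeriv u η * b η) * W η) 2 volume := by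
    refine MemLp.bdd_contDiff_mul (M := M + M + K * M)
      ((hb.add (hb.fderiv_dir u)).add (cκ.mul hb)) (fun η => norm_add₃_le.trans ?_) hW
    rw [norm_mul, Complex.norm_real]
    gcongr
    · exact hM η
    · exact hM' η
    · exact hK η
    · exact hM η
  have m2 : ∀ i, MemLp (fun η => (g i η * b η) * W η) 2 volume := fun i => by
    refine MemLp.bdd_contDiff_mul (M := 1 * M) ((hg i).mul hb) (fun η => ?_) hW
    rw [norm_mul]
    exact mul_le_mul (hg1 i η) (hM η) (norm_nonneg _) zero_le_one
  have e1 : ∫ η, ((1 + Complex.I * t) * θ η + fderiv ℝ θ η u) * W η =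
      oscOp Θ (fun η => (b η + fderiv ℝ b η u + weightLogDeriv u η * b η) * W η +
        ∑ i, c i * ((g i η * b η) * W η)) s := by
    refine integral_congr_ae (Filter.Eventually.of_forall fun η => ?_)
    have h1 : ∑ i, c i * ((g i η * b η) * W η) = (∑ i, c i * g i η) * b η * W η := by
      simp only [Finset.sum_mul]
      exact Finset.sum_congr rfl fun i _ => by ring
    simp only
    rw [h1, ← h η, hdθ]
    simp only [hθ, hD]
    push_cast
    ring
  have m3 : MemLp (fun η => ∑ i, c i * ((g i η * b η) * W η)) 2 volume :=
    memLp_finsetSum _ fun i _ => (m2 i).const_mul (c i)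
  rw [e0, main, e1, oscOp_add hΘ m1 m3, oscOp_sum hΘ c m2]
  refine (norm_add_le _ _).trans (add_le_add_right ((norm_sum_le _ _).trans
    (Finset.sum_le_sum fun i _ => ?_)) _)
  rw [norm_mul]
  exact mul_le_of_le_one_left (norm_nonneg _) (hc i)

end Oscillatory

section Localization

variable {E : Type*} [NormedAddCommGroup E] [InnerProductSpace ℝ E] [FiniteDimensional ℝ E]
  [MeasurableSpace E] [BorelSpace E]

/-- Iterated integration by parts: on a set `q` where the phase derivatives are controlled, the
extension operator is dominated by finitely many extension operators of localized functions. -/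
theorem exists_norm_oscOp_le_sum {σ ι Λ : Type} [Fintype σ] [Fintype Λ]
    {Θ : E → σ → ℝ} (hΘ : ContDiff ℝ ∞ Θ) {u : ι → E} {t : ι → ℝ} {q : Set (σ → ℝ)} {n : ℕ}
    {c : ι → Λ → (σ → ℝ) → ℂ} {g : ι → Λ → E → ℂ} (hc : ∀ j i, ∀ s ∈ q, ‖c j i s‖ ≤ 1)
    (hg : ∀ j i, ContDiff ℝ ∞ (g j i)) (hg1 : ∀ j i, DirBound u n 1 (g j i))
    (hκ : ∀ j, DirBound u n 1 (weightLogDeriv (u j)))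
    (h : ∀ j, ∀ s ∈ q, ∀ η, Complex.I *
      ((∑ l, s l * fderiv ℝ (fun η => Θ η l) η (u j) + t j : ℝ) : ℂ) = ∑ i, c j i s * g j i η)
    (L : List ι) {k : ℕ} (hk : k + L.length ≤ n) {M : ℝ} {b : E → ℂ} (hb : ContDiff ℝ ∞ b)
    (hbM : DirBound u (k + L.length) M b) :
    ∃ (T : Type) (_ : Fintype T) (b' : T → E → ℂ),
      Fintype.card T = (Fintype.card Λ + 1) ^ L.length ∧ (∀ τ, ContDiff ℝ ∞ (b' τ)) ∧
      (∀ τ, DirBound u k ((2 + 2 ^ n) ^ L.length * M) (b' τ)) ∧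
      ∀ (G : Lp ℂ 2 (volume : Measure E)), ∀ s ∈ q, ‖oscOp Θ (fun η => b η * G η) s‖ ≤
        ∑ τ, ‖oscOp Θ (fun η => b' τ η * dirResolventList u t L G η) s‖ := by
  induction L generalizing b M with
  | nil =>
    exact ⟨Unit, inferInstance, fun _ => b, by simp, fun _ => hb, fun _ => by simpa using hbM,
      fun G s _ => by simp [dirResolventList]⟩
  | cons j L ih =>
    have hM0 : 0 ≤ M := (norm_nonneg _).trans (hbM.norm_le 0)
    rw [List.length_cons, ← add_assoc] at hbM hk
    have hk' : k + L.length ≤ n := by omega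
    have cκ : ContDiff ℝ ∞ fun η => (weightLogDeriv (u j) η : ℂ) :=
      Complex.ofRealCLM.contDiff.comp (contDiff_weightLogDeriv (u j))
    set B : Option Λ → E → ℂ := fun o => o.elim
      (fun η => b η + fderiv ℝ b η (u j) + weightLogDeriv (u j) η * b η)
      (fun i η => g j i η * b η) with hB
    have hBc : ∀ o, ContDiff ℝ ∞ (B o) := by
      rintro (_ | i)
      · exact (hb.add (hb.fderiv_dir (u j))).add (cκ.mul hb)
      · exact (hg j i).mul hb
    have hpow : (2 : ℝ) ^ (k + L.length) ≤ 2 ^ n := pow_le_pow_right₀ one_le_two hk'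
    have hBM : ∀ o, DirBound u (k + L.length) ((2 + 2 ^ n) * M) (B o) := by
      rintro (_ | i)
      · refine (((hbM.of_succ.add hb (hb.fderiv_dir (u j)) (hbM.2 j)).add
          (hb.add (hb.fderiv_dir (u j))) (cκ.mul hb)
          ((((hκ j).of_le hk').ofReal (contDiff_weightLogDeriv (u j))).mul cκ hb
            hbM.of_succ))).mono_const ?_
        nlinarith
      · refine (((hg1 j i).of_le hk').mul (hg j i) hb hbM.of_succ).mono_const ?_
        nlinarith
    choose T hT b' hcard hbc hbb hle using fun o => ih hk' (hBc o) (hBM o)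
    refine ⟨Σ o, T o, inferInstance, fun τ => b' τ.1 τ.2, ?_, fun τ => hbc _ _, fun τ => ?_, ?_⟩
    · rw [Fintype.card_sigma]
      simp only [hcard, Finset.sum_const, Finset.card_univ, Fintype.card_option, smul_eq_mul,
        List.length_cons]
      ring
    · convert hbb τ.1 τ.2 using 1
      rw [List.length_cons]
      ring
    · intro G s hs
      refine (norm_oscOp_mul_le hΘ (u j) (t j) hb hbM.norm_le (hbM.2 j).norm_le (hκ j).norm_le G
        (fun i => hc j i s hs) (hg j) (fun i => (hg1 j i).norm_le) (h j s hs)).trans ?_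
      rw [Fintype.sum_sigma, Fintype.sum_option]
      exact add_le_add (hle none _ s hs) (Finset.sum_le_sum fun i _ => hle (some i) _ s hs)

/-- The `i`-th surface `Θ` is a small perturbation of the `i`-th coordinate hyperplane, with
respect to the parameter directions `v`. -/
structure NearCoord {n : ℕ} (i : Fin (n + 2)) (δ B : ℝ) (v : Fin (n + 1) → E)
    (Θ : E → Fin (n + 2) → ℝ) : Prop where
  contDiff : ContDiff ℝ ∞ Θ
  norm_dir_le : ∀ j, ‖v j‖ ≤ B
  small : ∀ j l η, |fderiv ℝ (fun η => Θ η l) η (v j) - if l = i.succAbove j then 1 else 0| ≤ δ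
  bound : ∀ j l, DirBound v (n + 1) B
    fun η => fderiv ℝ (fun η => Θ η l) η (v j) - if l = i.succAbove j then (1 : ℝ) else 0

theorem weightLogDeriv_smul (r : ℝ) (v : E) :
    weightLogDeriv (r • v) = fun η => r • weightLogDeriv v η := by
  ext η
  simp only [weightLogDeriv, inner_smul_right, smul_eq_mul]
  ring

/-- On a cube of side `R` inside a cube of side `R / δ` the extension operator sees only the part
of the function that is localized near the projection of the cube. -/
theorem exists_oscOp_localization (E : Type*) [NormedAddCommGroup E] [InnerProductSpace ℝ E]
    [FiniteDimensional ℝ E] [MeasurableSpace E] [BorelSpace E] (n : ℕ) {δ : ℝ} (hδ : 0 < δ)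
    (B : ℝ) :
    ∃ R₀ : ℝ, 1 ≤ R₀ ∧ ∀ R, R₀ ≤ R → ∀ (i : Fin (n + 2)) (v : Fin (n + 1) → E)
      (Θ : E → Fin (n + 2) → ℝ), NearCoord i δ B v Θ → ∀ k : Fin (n + 2) → ℤ,
      ∃ (T : Type) (_ : Fintype T) (b : T → E → ℂ),
        Fintype.card T = (n + 4) ^ (n + 1) ∧ (∀ τ, ContDiff ℝ ∞ (b τ)) ∧
        (∀ τ η, ‖b τ η‖ ≤ (2 + 2 ^ (n + 1)) ^ (n + 1)) ∧
        ∀ (G : Lp ℂ 2 (volume : Measure E)),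
          ∀ s ∈ Metric.ball (fun l => R * (k l : ℝ)) R ∩ Metric.ball 0 (R / δ),
          ‖oscOp Θ G s‖ ≤ ∑ τ, ‖oscOp Θ (fun η => b τ η *
            dirResolventList (fun j => R⁻¹ • v j) (fun j => -(k (i.succAbove j) : ℝ))
              (List.finRange (n + 1)) G η) s‖ := by
  obtain ⟨Mκ, hMκ⟩ := exists_dirBound_weightLogDeriv (E := E) (Fin (n + 1)) (n + 1) B
  refine ⟨max 1 (max (δ⁻¹ * B) Mκ), le_max_left _ _, fun R hR i v Θ hΘ k => ?_⟩
  have hR1 : 1 ≤ R := (le_max_left _ _).trans hR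
  have hRB : δ⁻¹ * B ≤ R := ((le_max_left _ _).trans (le_max_right _ _)).trans hR
  have hRM : Mκ ≤ R := ((le_max_right _ _).trans (le_max_right _ _)).trans hR
  have hR0 : 0 < R := zero_lt_one.trans_le hR1
  have hRi : R⁻¹ ≤ 1 := inv_le_one_of_one_le₀ hR1
  have hRi0 : 0 ≤ R⁻¹ := inv_nonneg.2 hR0.le
  set f : Fin (n + 1) → Fin (n + 2) → E → ℝ := fun j l η =>
    fderiv ℝ (fun η => Θ η l) η (v j) - if l = i.succAbove j then (1 : ℝ) else 0 with hf
  have cf : ∀ j l, ContDiff ℝ ∞ (f j l) := fun j l =>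
    ((contDiff_pi.1 hΘ.contDiff l).fderiv_dir (v j)).sub contDiff_const
  set g : Fin (n + 1) → Option (Fin (n + 2)) → E → ℂ := fun j o =>
    o.elim (fun _ => 1) fun l η => ((δ⁻¹ • f j l η : ℝ) : ℂ) with hg
  set c : Fin (n + 1) → Option (Fin (n + 2)) → (Fin (n + 2) → ℝ) → ℂ := fun j o s =>
    Complex.I * ((o.elim (R⁻¹ * s (i.succAbove j) - k (i.succAbove j))
      fun l => R⁻¹ * s l * δ : ℝ) : ℂ) with hc
  have key := exists_norm_oscOp_le_sum (u := fun j => R⁻¹ • v j)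
    (t := fun j => -(k (i.succAbove j) : ℝ))
    (q := Metric.ball (fun l => R * (k l : ℝ)) R ∩ Metric.ball 0 (R / δ)) (n := n + 1)
    (c := c) (g := g) hΘ.contDiff ?_ ?_ ?_ ?_ ?_ (List.finRange (n + 1)) (k := 0) (by simp) (M := 1)
    (b := fun _ => 1) contDiff_const (DirBound.const (by simp) _)
  · obtain ⟨T, hT, b, h1, h2, h3, h4⟩ := key
    refine ⟨T, hT, b, by simpa using h1, h2, fun τ η => by simpa using h3 τ η, fun G s hs => ?_⟩
    simpa using h4 G s hs
  · intro j o s hs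
    simp only [hc, norm_mul, Complex.norm_I, one_mul, Complex.norm_real]
    obtain ⟨hs1, hs2⟩ := hs
    rw [Metric.mem_ball, dist_pi_lt_iff hR0] at hs1
    rw [Metric.mem_ball, dist_pi_lt_iff (by positivity)] at hs2
    rcases o with _ | l
    · have h1 := hs1 (i.succAbove j)
      rw [Real.dist_eq] at h1
      have h2 : R⁻¹ * s (i.succAbove j) - k (i.succAbove j) =
          R⁻¹ * (s (i.succAbove j) - R * k (i.succAbove j)) := by field_simp
      simp only [Option.elim_none]
      rw [h2, norm_mul, Real.norm_of_nonneg hRi0, Real.norm_eq_abs, inv_mul_le_iff₀ hR0]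
      linarith
    · have h1 := hs2 l
      rw [Real.dist_eq, Pi.zero_apply, sub_zero] at h1
      simp only [Option.elim_some]
      rw [norm_mul, norm_mul, Real.norm_of_nonneg hRi0, Real.norm_eq_abs, Real.norm_of_nonneg hδ.le,
        mul_assoc, inv_mul_le_iff₀ hR0, mul_one]
      exact ((lt_div_iff₀ hδ).1 h1).le
  · rintro j (_ | l)
    · exact contDiff_const
    · exact Complex.ofRealCLM.contDiff.comp ((cf j l).const_smul δ⁻¹)
  · rintro j (_ | l)
    · exact DirBound.const (c := (1 : ℂ)) (by simp) _
    · refine DirBound.ofReal ((cf j l).const_smul δ⁻¹) (((hΘ.bound j l).const_smul (cf j l)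
        δ⁻¹).rescale ((cf j l).const_smul δ⁻¹) (fun η => ?_) hRi0 hRi ?_)
      · rw [norm_smul, Real.norm_of_nonneg (inv_nonneg.2 hδ.le), inv_mul_le_iff₀ hδ, mul_one]
        exact hΘ.small j l η
      · rw [abs_of_nonneg (inv_nonneg.2 hδ.le), inv_mul_le_iff₀ hR0, mul_one]
        exact hRB
  · intro j
    rw [weightLogDeriv_smul]
    refine (((hMκ v hΘ.norm_dir_le j).const_smul (contDiff_weightLogDeriv _) R⁻¹).mono_const
      ?_).smul_dir ((contDiff_weightLogDeriv _).const_smul _) (by rwa [abs_of_nonneg hRi0])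
    rw [abs_of_nonneg hRi0, inv_mul_le_iff₀ hR0, mul_one]
    exact hRM
  · intro j s _ η
    rw [Fintype.sum_option]
    simp only [hc, hg, Option.elim_none, Option.elim_some, mul_one, mul_assoc]
    rw [← Finset.mul_sum, ← mul_add]
    congr 1
    norm_cast
    have h1 : ∀ l, s l * fderiv ℝ (fun η => Θ η l) η (R⁻¹ • v j) =
        (if l = i.succAbove j then R⁻¹ * s l else 0) + R⁻¹ * (s l * (δ * δ⁻¹ • f j l η)) := by
      intro l
      rw [map_smul, smul_eq_mul, smul_eq_mul, mul_inv_cancel_left₀ hδ.ne']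
      simp only [hf]
      split_ifs <;> ring
    simp only [h1, Finset.sum_add_distrib, Finset.sum_ite_eq', Finset.mem_univ, if_true, ← Finset.mul_sum, mul_assoc]
    push_cast
    ring

end Localization

section InductionOnScales

theorem ENNReal.sum_rpow_le_card_rpow_mul_sum {T : Type*} [Fintype T] (a : T → ℝ≥0∞) {p : ℝ}
    (hp : 0 < p) : (∑ τ, a τ) ^ p ≤ (Fintype.card T : ℝ≥0∞) ^ p * ∑ τ, a τ ^ p := by
  rcases isEmpty_or_nonempty T with h | h
  · simp [hp]
  obtain ⟨τ, -, hτ⟩ := Finset.exists_max_image Finset.univ a Finset.univ_nonempty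
  calc (∑ τ, a τ) ^ p ≤ (Fintype.card T * a τ) ^ p := by
        gcongr
        refine (Finset.sum_le_card_nsmul _ _ (a τ) fun i hi => hτ i hi).trans ?_
        simp
    _ = (Fintype.card T : ℝ≥0∞) ^ p * a τ ^ p := ENNReal.mul_rpow_of_nonneg _ _ hp.le
    _ ≤ _ := by
        gcongr
        exact Finset.single_le_sum (f := fun τ => a τ ^ p) (fun _ _ => zero_le) (Finset.mem_univ τ)

/-- The power of a product of sums is dominated by the sum of the powers of the products. -/
theorem ENNReal.prod_sum_rpow_le {ι : Type*} [Fintype ι] [DecidableEq ι] {T : ι → Type*}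
    [∀ i, Fintype (T i)] (a : ∀ i, T i → ℝ≥0∞) {p : ℝ} (hp : 0 < p) {N : ℕ}
    (hN : ∀ i, Fintype.card (T i) ≤ N) :
    ∏ i, (∑ τ, a i τ) ^ p ≤ ((N : ℝ≥0∞) ^ p) ^ Fintype.card ι * ∑ τ : ∀ i, T i, ∏ i, a i (τ i) ^ p := by
  calc _ ≤ ∏ i, ((N : ℝ≥0∞) ^ p * ∑ τ, a i τ ^ p) :=
        Finset.prod_le_prod' fun i _ => by
          refine (ENNReal.sum_rpow_le_card_rpow_mul_sum _ hp).trans ?_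
          gcongr
          exact hN i
    _ = _ := by
        rw [Finset.prod_mul_distrib, Finset.prod_const, Finset.card_univ, Finset.prod_univ_sum,
          Fintype.piFinset_univ]

variable {E : Type*} [NormedAddCommGroup E] [InnerProductSpace ℝ E] [FiniteDimensional ℝ E]
  [MeasurableSpace E] [BorelSpace E] {n : ℕ}

theorem continuous_oscOp {σ : Type*} [Fintype σ] {Θ : E → σ → ℝ} (hΘ : ContDiff ℝ ∞ Θ) {F : E → ℂ}
    (hF : MemLp F 2 volume) : Continuous (oscOp Θ F) := by
  refine continuous_of_dominated (bound := fun η => decayWeight η * ‖F η‖) (fun s =>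
    (MemLp.integrable_mul (memLp_oscKernel hΘ s) hF).1) (fun s => Filter.Eventually.of_forall
      fun η => by rw [norm_mul, norm_oscKernel]) ?_ (Filter.Eventually.of_forall fun η => ?_)
  · exact MemLp.integrable_mul memLp_decayWeight hF.norm
  · fun_prop

/-- The multilinear estimate on the cube of side `R` centred at the origin, with constant `D`. -/
def MultBound (μ : Measure (Fin (n + 2) → ℝ)) (Θ : Fin (n + 2) → E → Fin (n + 2) → ℝ) (R : ℝ)
    (D : ℝ≥0∞) : Prop :=
  ∀ F : Fin (n + 2) → E → ℂ, (∀ i, MemLp (F i) 2 volume) →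
    ∫⁻ s in Metric.ball 0 R, ∏ i, ‖oscOp (Θ i) (F i) s‖ₑ ^ (2 / ((n + 1 : ℕ) : ℝ)) ∂μ ≤
      D * ∏ i, eLpNorm (F i) 2 volume ^ (2 / ((n + 1 : ℕ) : ℝ))

variable {μ : Measure (Fin (n + 2) → ℝ)} {Θ : Fin (n + 2) → E → Fin (n + 2) → ℝ} {R : ℝ}
  {D : ℝ≥0∞}

theorem MultBound.mono (h : MultBound μ Θ R D) {R' : ℝ} {D' : ℝ≥0∞} (hR : R' ≤ R) (hD : D ≤ D') :
    MultBound μ Θ R' D' := fun F hF =>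
  (lintegral_mono_set (Metric.ball_subset_ball hR)).trans ((h F hF).trans (by gcongr))

theorem MultBound.translate [μ.IsAddLeftInvariant] (h : MultBound μ Θ R D)
    (hΘ : ∀ i, ContDiff ℝ ∞ (Θ i)) (c : Fin (n + 2) → ℝ) {F : Fin (n + 2) → E → ℂ}
    (hF : ∀ i, MemLp (F i) 2 volume) :
    ∫⁻ s in Metric.ball c R, ∏ i, ‖oscOp (Θ i) (F i) s‖ₑ ^ (2 / ((n + 1 : ℕ) : ℝ)) ∂μ ≤
      D * ∏ i, eLpNorm (F i) 2 volume ^ (2 / ((n + 1 : ℕ) : ℝ)) := by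
  set F' : Fin (n + 2) → E → ℂ := fun i η =>
    Complex.exp (Complex.I * ((∑ l, c l * Θ i η l : ℝ) : ℂ)) * F i η with hF'
  have hn : ∀ i η, ‖F' i η‖ = ‖F i η‖ := fun i η => by
    rw [hF', norm_mul, norm_exp_I_mul_ofReal, one_mul]
  have hc : ∀ i, Continuous fun η => Complex.exp (Complex.I * ((∑ l, c l * Θ i η l : ℝ) : ℂ)) :=
    fun i => by
      have := (hΘ i).continuous
      fun_prop
  have hm : ∀ i, MemLp (F' i) 2 volume := fun i =>
    (hF i).mono ((hc i).aestronglyMeasurable.mul (hF i).1)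
      (Filter.Eventually.of_forall fun η => (hn i η).le)
  have he : ∀ i, eLpNorm (F' i) 2 volume = eLpNorm (F i) 2 volume := fun i =>
    eLpNorm_congr_norm_ae (Filter.Eventually.of_forall (hn i))
  have h1 := h F' hm
  simp only [he] at h1
  simp only [hF', ← oscOp_add_arg] at h1
  convert h1 using 1
  rw [← lintegral_indicator measurableSet_ball, ← lintegral_indicator measurableSet_ball,
    ← lintegral_add_right_eq_self _ c]
  refine lintegral_congr fun s => ?_
  simp only [indicator, Metric.mem_ball, dist_eq_norm, add_sub_cancel_right, sub_zero]

theorem enorm_toLp_two {F : E → ℂ} (hF : MemLp F 2 volume) :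
    ‖hF.toLp‖ₑ = eLpNorm F 2 volume := by
  rw [Lp.enorm_def]
  exact eLpNorm_congr_ae hF.coeFn_toLp

theorem oscOp_congr {σ : Type*} [Fintype σ] {Θ : E → σ → ℝ} {F G : E → ℂ} (h : F =ᵐ[volume] G) :
    oscOp Θ F = oscOp Θ G := by
  ext s
  refine integral_congr_ae ?_
  filter_upwards [h] with η hη
  rw [hη]

/-- Passing from scale `R` to scale `R / δ` loses a constant independent of `δ`. -/
theorem exists_multBound_step (E : Type*) [NormedAddCommGroup E] [InnerProductSpace ℝ E]
    [FiniteDimensional ℝ E] [MeasurableSpace E] [BorelSpace E] (n : ℕ) :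
    ∃ C : ℝ≥0, ∀ δ B : ℝ, 0 < δ → ∃ R₀ : ℝ, 1 ≤ R₀ ∧ ∀ (μ : Measure (Fin (n + 2) → ℝ)) [μ.IsAddLeftInvariant]
      (Θ : Fin (n + 2) → E → Fin (n + 2) → ℝ) (v : Fin (n + 2) → Fin (n + 1) → E),
      (∀ i, NearCoord i δ B (v i) (Θ i)) → ∀ R, R₀ ≤ R → ∀ D,
      MultBound μ Θ R D → MultBound μ Θ (R / δ) (C * D) := by
  obtain ⟨CL, hCL⟩ := exists_tsum_dirResolventList_le (E := E) (n + 1)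
  set p : ℝ := 2 / ((n + 1 : ℕ) : ℝ) with hp
  have hp0 : 0 < p := by positivity
  obtain ⟨N, hN⟩ : ∃ N, N = (n + 4) ^ (n + 1) := ⟨_, rfl⟩
  set M : ℝ≥0 := (2 + 2 ^ (n + 1)) ^ (n + 1) with hM
  set C₁ : ℝ≥0 := ((N : ℝ≥0) ^ p) ^ (n + 2) * (N ^ (n + 2) * (M ^ p) ^ (n + 2)) with hC₁
  refine ⟨C₁ * (CL ^ (1 / ((n + 1 : ℕ) : ℝ))) ^ (n + 2), fun δ B hδ => ?_⟩
  obtain ⟨R₀, hR₀1, hR₀⟩ := exists_oscOp_localization E n hδ B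
  refine ⟨R₀, hR₀1, fun μ _ Θ v hΘ R hR D hD F hF => ?_⟩
  have hRpos : 0 < R := by linarith
  set G : Fin (n + 2) → Lp ℂ 2 (volume : Measure E) := fun i => (hF i).toLp with hG
  have hFG : ∀ i, oscOp (Θ i) (F i) = oscOp (Θ i) (G i) := fun i =>
    oscOp_congr (hF i).coeFn_toLp.symm
  set W : Fin (n + 2) → (Fin (n + 1) → ℤ) → Lp ℂ 2 (volume : Measure E) := fun i m =>
    dirResolventList (fun j => R⁻¹ • v i j) (fun j => -(m j : ℝ)) (List.finRange (n + 1)) (G i)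
    with hW
  -- the estimate on one cube
  have cube : ∀ k : Fin (n + 2) → ℤ,
      ∫⁻ s in Metric.ball (fun l => R * (k l : ℝ)) R ∩ Metric.ball 0 (R / δ),
        ∏ i, ‖oscOp (Θ i) (F i) s‖ₑ ^ p ∂μ ≤
      C₁ * D * ∏ i, (‖W i (k ∘ i.succAbove)‖ₑ ^ 2) ^ (1 / ((n + 1 : ℕ) : ℝ)) := by
    intro k
    choose T hT b hcard hbc hbM hle using fun i => hR₀ R hR i (v i) (Θ i) (hΘ i) k
    simp only [← hN] at hcard
    have hm : ∀ i τ, MemLp (fun η => b i τ η * W i (k ∘ i.succAbove) η) 2 volume := fun i τ =>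
      MemLp.bdd_contDiff_mul (hbc i τ) (hbM i τ) (Lp.memLp _)
    have hnorm : ∀ i τ, eLpNorm (fun η => b i τ η * W i (k ∘ i.succAbove) η) 2 volume ≤
        M * ‖W i (k ∘ i.succAbove)‖ₑ := fun i τ => by
      rw [Lp.enorm_def]
      refine eLpNorm_le_nnreal_smul_eLpNorm_of_ae_le_mul (Filter.Eventually.of_forall fun η => ?_) 2
      rw [nnnorm_mul]
      gcongr
      rw [← NNReal.coe_le_coe, hM]
      push_cast
      exact hbM i τ η
    have hmeas : ∀ τ : ∀ i, T i, Measurable fun s =>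
        ∏ i, ‖oscOp (Θ i) (fun η => b i (τ i) η * W i (k ∘ i.succAbove) η) s‖ₑ ^ p := fun τ =>
      Finset.measurable_prod _ fun i _ =>
        (continuous_oscOp (hΘ i).contDiff (hm i (τ i))).measurable.enorm.pow_const p
    calc _ ≤ ∫⁻ s in Metric.ball (fun l => R * (k l : ℝ)) R ∩ Metric.ball 0 (R / δ),
          ((N : ℝ≥0∞) ^ p) ^ (n + 2) * ∑ τ : ∀ i, T i,
            ∏ i, ‖oscOp (Θ i) (fun η => b i (τ i) η * W i (k ∘ i.succAbove) η) s‖ₑ ^ p ∂μ := by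
          refine setLIntegral_mono (measurable_const.mul
            (Finset.measurable_sum _ fun τ _ => hmeas τ)) fun s hs => ?_
          have h1 := ENNReal.prod_sum_rpow_le (fun i τ =>
            ‖oscOp (Θ i) (fun η => b i τ η * W i (k ∘ i.succAbove) η) s‖ₑ) hp0 fun i => (hcard i).le
          rw [Fintype.card_fin] at h1
          refine le_trans (Finset.prod_le_prod' fun i _ => ?_) h1
          gcongr
          rw [hFG]
          simp only [← ofReal_norm]
          rw [← ENNReal.ofReal_sum_of_nonneg fun _ _ => norm_nonneg _]
          exact ENNReal.ofReal_le_ofReal (hle i (G i) s hs)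
      _ ≤ ∫⁻ s in Metric.ball (fun l => R * (k l : ℝ)) R,
          ((N : ℝ≥0∞) ^ p) ^ (n + 2) * ∑ τ : ∀ i, T i,
            ∏ i, ‖oscOp (Θ i) (fun η => b i (τ i) η * W i (k ∘ i.succAbove) η) s‖ₑ ^ p ∂μ :=
          lintegral_mono_set inter_subset_left
      _ = ((N : ℝ≥0∞) ^ p) ^ (n + 2) * ∑ τ : ∀ i, T i,
          ∫⁻ s in Metric.ball (fun l => R * (k l : ℝ)) R,
            ∏ i, ‖oscOp (Θ i) (fun η => b i (τ i) η * W i (k ∘ i.succAbove) η) s‖ₑ ^ p ∂μ := by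
          rw [lintegral_const_mul _ (Finset.measurable_sum _ fun τ _ => hmeas τ),
            lintegral_finsetSum _ fun τ _ => hmeas τ]
      _ ≤ ((N : ℝ≥0∞) ^ p) ^ (n + 2) * ∑ τ : ∀ i, T i,
            D * ∏ i, (M * ‖W i (k ∘ i.succAbove)‖ₑ) ^ p := by
          gcongr with τ
          refine (hD.translate (fun i => (hΘ i).contDiff) _ fun i => hm i (τ i)).trans ?_
          gcongr with i
          exact hnorm i (τ i)
      _ = _ := by
          have h1 : ∀ i, (‖W i (k ∘ i.succAbove)‖ₑ ^ 2) ^ (1 / ((n + 1 : ℕ) : ℝ)) =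
              ‖W i (k ∘ i.succAbove)‖ₑ ^ p := fun i => by
            rw [← ENNReal.rpow_natCast, ← ENNReal.rpow_mul, hp]
            congr 1
            push_cast
            ring
          simp only [h1, ENNReal.mul_rpow_of_nonneg _ _ hp0.le, Finset.prod_mul_distrib,
            Finset.prod_const, Finset.sum_const, Finset.card_univ, Fintype.card_fin,
            Fintype.card_pi, hcard, nsmul_eq_mul]
          rw [hC₁]
          simp only [ENNReal.coe_mul, ENNReal.coe_pow, ENNReal.coe_rpow_of_nonneg _ hp0.le,
            ENNReal.coe_natCast, Nat.cast_pow]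
          ring
  have cover : Metric.ball (0 : Fin (n + 2) → ℝ) (R / δ) ⊆ ⋃ k : Fin (n + 2) → ℤ,
      Metric.ball (fun l => R * (k l : ℝ)) R ∩ Metric.ball 0 (R / δ) := by
    intro s hs
    refine mem_iUnion.2 ⟨fun l => ⌊s l / R⌋, ?_, hs⟩
    rw [Metric.mem_ball, dist_pi_lt_iff hRpos]
    intro l
    have h1 := Int.floor_le (s l / R)
    have h2 := Int.lt_floor_add_one (s l / R)
    rw [le_div_iff₀ hRpos] at h1
    rw [div_lt_iff₀ hRpos] at h2
    rw [Real.dist_eq, abs_lt]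
    constructor <;> nlinarith
  calc _ ≤ ∑' k : Fin (n + 2) → ℤ,
        ∫⁻ s in Metric.ball (fun l => R * (k l : ℝ)) R ∩ Metric.ball 0 (R / δ),
          ∏ i, ‖oscOp (Θ i) (F i) s‖ₑ ^ p ∂μ :=
        (lintegral_mono_set cover).trans (lintegral_iUnion_le _ _)
    _ ≤ ∑' k : Fin (n + 2) → ℤ,
        C₁ * D * ∏ i, (‖W i (k ∘ i.succAbove)‖ₑ ^ 2) ^ (1 / ((n + 1 : ℕ) : ℝ)) :=
        ENNReal.tsum_le_tsum cube
    _ ≤ C₁ * D * ∏ i, (∑' m, ‖W i m‖ₑ ^ 2) ^ (1 / ((n + 1 : ℕ) : ℝ)) := by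
        rw [ENNReal.tsum_mul_left]
        gcongr
        exact tsum_prod_succAbove_le n fun i m => ‖W i m‖ₑ ^ 2
    _ ≤ C₁ * D * ∏ i, (CL * ‖G i‖ₑ ^ 2) ^ (1 / ((n + 1 : ℕ) : ℝ)) := by
        gcongr with i
        exact hCL _ (G i)
    _ = _ := by
        have hq : (0 : ℝ) ≤ 1 / ((n + 1 : ℕ) : ℝ) := by positivity
        have h1 : ∀ i, (‖G i‖ₑ ^ 2) ^ (1 / ((n + 1 : ℕ) : ℝ)) = eLpNorm (F i) 2 volume ^ p :=
            fun i => by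
          rw [← ENNReal.rpow_natCast, ← ENNReal.rpow_mul, hp, hG, enorm_toLp_two]
          congr 1
          push_cast
          ring
        simp only [ENNReal.mul_rpow_of_nonneg _ _ hq, h1, Finset.prod_mul_distrib,
            Finset.prod_const, Finset.card_univ, Fintype.card_fin]
        simp only [ENNReal.coe_mul, ENNReal.coe_pow, ENNReal.coe_rpow_of_nonneg _ hq]
        ring

/-- The trivial estimate at a fixed scale. -/
theorem exists_multBound_base (E : Type*) [NormedAddCommGroup E] [InnerProductSpace ℝ E]
    [FiniteDimensional ℝ E] [MeasurableSpace E] [BorelSpace E] (n : ℕ) :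
    ∃ C : ℝ≥0, ∀ (μ : Measure (Fin (n + 2) → ℝ)) (Θ : Fin (n + 2) → E → Fin (n + 2) → ℝ) (R : ℝ),
      MultBound μ Θ R (C * μ (Metric.ball 0 R)) := by
  obtain ⟨C, hC⟩ := exists_norm_oscOp_le E
  have hp0 : (0 : ℝ) ≤ 2 / ((n + 1 : ℕ) : ℝ) := by positivity
  refine ⟨(C ^ (2 / ((n + 1 : ℕ) : ℝ))) ^ (n + 2), fun μ Θ R F hF => ?_⟩
  calc _ ≤ ∫⁻ s in Metric.ball 0 R,
        ∏ i, (C * eLpNorm (F i) 2 volume) ^ (2 / ((n + 1 : ℕ) : ℝ)) ∂μ := by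
        refine lintegral_mono fun s => Finset.prod_le_prod' fun i _ => ?_
        gcongr
        exact hC (Θ i) (F i) s (hF i)
    _ = _ := by
        simp only [lintegral_const, Measure.restrict_apply MeasurableSet.univ, univ_inter,
          ENNReal.mul_rpow_of_nonneg _ _ hp0, Finset.prod_mul_distrib,
          Finset.prod_const, Finset.card_univ, Fintype.card_fin]
        simp only [ENNReal.coe_pow, ENNReal.coe_rpow_of_nonneg _ hp0]
        ring

/-- The multilinear estimate for small perturbations of the coordinate hyperplanes. -/
theorem exists_multBound (E : Type*) [NormedAddCommGroup E] [InnerProductSpace ℝ E]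
    [FiniteDimensional ℝ E] [MeasurableSpace E] [BorelSpace E] (n : ℕ) {ε : ℝ} (hε : 0 < ε) :
    ∃ δ : ℝ, 0 < δ ∧ ∀ B : ℝ, ∃ (R₀ : ℝ) (C : ℝ≥0),
      ∀ (μ : Measure (Fin (n + 2) → ℝ)) [μ.IsAddLeftInvariant]
        (Θ : Fin (n + 2) → E → Fin (n + 2) → ℝ) (v : Fin (n + 2) → Fin (n + 1) → E),
        (∀ i, NearCoord i δ B (v i) (Θ i)) → ∀ R, 1 ≤ R →
        MultBound μ Θ R (C * μ (Metric.ball 0 R₀) * ENNReal.ofReal (R ^ ε)) := by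
  obtain ⟨C₁, hC₁⟩ := exists_multBound_step E n
  set l : ℝ := (C₁ + 2) ^ (1 / ε) with hl
  have hl1 : 1 < l := Real.one_lt_rpow (by linarith [C₁.coe_nonneg]) (by positivity)
  have hl0 : 0 < l := by linarith
  have hlε : l ^ ε = C₁ + 2 := by
    rw [hl, ← Real.rpow_mul (by linarith [C₁.coe_nonneg]), one_div_mul_cancel hε.ne', Real.rpow_one]
  refine ⟨l⁻¹, inv_pos.2 hl0, fun B => ?_⟩
  obtain ⟨R₀, hR₀, hstep⟩ := hC₁ l⁻¹ B (inv_pos.2 hl0)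
  obtain ⟨C₀, hbase⟩ := exists_multBound_base E n
  refine ⟨R₀, C₀ * (C₁ + 2), fun μ _ Θ v hΘ R hR => ?_⟩
  have iter : ∀ j : ℕ, MultBound μ Θ (R₀ * l ^ j) (C₁ ^ j * (C₀ * μ (Metric.ball 0 R₀))) := by
    intro j
    induction j with
    | zero => simpa using hbase μ Θ R₀
    | succ j ih =>
      have h1 := hstep μ Θ v hΘ (R₀ * l ^ j)
        (le_mul_of_one_le_right (by linarith) (one_le_pow₀ hl1.le)) _ ih
      rw [div_inv_eq_mul, mul_assoc, ← pow_succ, ← mul_assoc, ← pow_succ'] at h1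
      exact h1
  obtain ⟨j, hj1, hj2⟩ := exists_nat_pow_near hR hl1
  refine (iter (j + 1)).mono ?_ ?_
  · nlinarith [pow_pos hl0 (j + 1)]
  · have h1 : ((C₁ : ℝ) + 2) ^ (j + 1) ≤ (C₁ + 2) * R ^ ε := by
      rw [pow_succ', ← hlε, ← Real.rpow_natCast, ← Real.rpow_mul hl0.le, mul_comm ε,
        Real.rpow_mul hl0.le, Real.rpow_natCast]
      gcongr
    calc (C₁ : ℝ≥0∞) ^ (j + 1) * (C₀ * μ (Metric.ball 0 R₀))
        ≤ ENNReal.ofReal ((C₁ + 2) * R ^ ε) * (C₀ * μ (Metric.ball 0 R₀)) := by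
          gcongr
          rw [← ENNReal.ofReal_coe_nnreal, ← ENNReal.ofReal_pow C₁.coe_nonneg]
          refine ENNReal.ofReal_le_ofReal (le_trans ?_ h1)
          gcongr
          linarith
      _ = _ := by
          rw [ENNReal.ofReal_mul (by linarith [C₁.coe_nonneg]), ENNReal.ofReal_add C₁.coe_nonneg (by norm_num),
            ENNReal.ofReal_coe_nnreal]
          push_cast
          rw [ENNReal.ofReal_ofNat]
          ring

end InductionOnScales

section Remainder

theorem DirBound.of_norm_iteratedFDeriv_le {E G ι : Type*} [NormedAddCommGroup E] [NormedSpace ℝ E]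
    [NormedAddCommGroup G] [NormedSpace ℝ G] {v : ι → E} {b : ℝ} (hb : 1 ≤ b) (hv : ∀ j, ‖v j‖ ≤ b)
    {k : ℕ} {M : ℝ} {f : E → G} (hf : ContDiff ℝ ∞ f)
    (h : ∀ m ≤ k, ∀ η, ‖iteratedFDeriv ℝ m f η‖ ≤ M) : DirBound v k (b ^ k * M) f := by
  have hM : 0 ≤ M := (norm_nonneg _).trans (h 0 (zero_le) 0)
  have h0 : ∀ η, ‖f η‖ ≤ M := fun η => by simpa using h 0 (zero_le) η
  induction k generalizing f M with
  | zero => exact fun η => by simpa using h0 η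
  | succ k ih =>
    refine ⟨fun η => (h0 η).trans (le_mul_of_one_le_left hM (one_le_pow₀ hb)), fun j => ?_⟩
    have h1 : ∀ m ≤ k, ∀ η, ‖iteratedFDeriv ℝ m (fun η => fderiv ℝ f η (v j)) η‖ ≤ b * M := by
      intro m hm η
      have h2 := (ContinuousLinearMap.apply ℝ G (v j)).norm_iteratedFDeriv_comp_left (x := η)
        (f := fderiv ℝ f) (n := m) (N := ∞)
        ((hf.fderiv_right (m := ∞) (by simp)).contDiffAt) (by exact_mod_cast le_top)
      rw [norm_iteratedFDeriv_fderiv] at h2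
      refine h2.trans (mul_le_mul ?_ (h (m + 1) (by omega) η) (norm_nonneg _) (by linarith))
      refine ContinuousLinearMap.opNorm_le_bound _ (by linarith) fun L => ?_
      rw [ContinuousLinearMap.apply_apply, mul_comm]
      exact (L.le_opNorm _).trans (mul_le_mul_of_nonneg_left (hv j) (norm_nonneg _))
    convert ih (hf.fderiv_dir (v j)) h1 (by positivity) (fun η => by simpa using h1 0 (zero_le) η)
      using 1
    ring

theorem exists_smooth_cutoff (E : Type*) [NormedAddCommGroup E] [InnerProductSpace ℝ E]
    [FiniteDimensional ℝ E] : ∃ C : ℝ, 0 ≤ C ∧ ∀ ρ : ℝ, 0 < ρ → ∃ M : ℕ → ℝ, ∀ p : E,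
      ∃ χ : E → ℝ, ContDiff ℝ ∞ χ ∧ (∀ η ∈ Metric.closedBall p ρ, χ η = 1) ∧ (∀ η, ‖χ η‖ ≤ 1) ∧
        tsupport χ ⊆ Metric.closedBall p (2 * ρ) ∧ (∀ η, ‖fderiv ℝ χ η‖ ≤ C / ρ) ∧
        ∀ m η, ‖iteratedFDeriv ℝ m χ η‖ ≤ M m := by
  let f : ContDiffBump (0 : E) := ⟨1, 2, zero_lt_one, one_lt_two⟩
  have cf : ContDiff ℝ ∞ f := f.contDiff
  obtain ⟨C, hC⟩ := f.hasCompactSupport.fderiv (𝕜 := ℝ) |>.exists_bound_of_continuous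
    (cf.continuous_fderiv (by simp))
  refine ⟨C, (norm_nonneg _).trans (hC 0), fun ρ hρ => ?_⟩
  have cg : ContDiff ℝ ∞ fun z : E => f (ρ⁻¹ • z) := cf.comp (contDiff_id.const_smul ρ⁻¹)
  have sg : HasCompactSupport fun z : E => f (ρ⁻¹ • z) :=
    f.hasCompactSupport.comp_smul (inv_ne_zero hρ.ne')
  have hM : ∀ m : ℕ, ∃ M, ∀ z, ‖iteratedFDeriv ℝ m (fun z : E => f (ρ⁻¹ • z)) z‖ ≤ M := fun m =>
    (sg.iteratedFDeriv (𝕜 := ℝ) m).exists_bound_of_continuous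
      (cg.continuous_iteratedFDeriv (by exact_mod_cast le_top))
  choose M hM using hM
  refine ⟨M, fun p => ⟨fun η => f (ρ⁻¹ • (η - p)), cg.comp (contDiff_id.sub contDiff_const),
    fun η hη => ?_, fun η => ?_, ?_, fun η => ?_, fun m η => ?_⟩⟩
  · refine f.one_of_mem_closedBall ?_
    rw [mem_closedBall_zero_iff, norm_smul, norm_inv, Real.norm_of_nonneg hρ.le,
      inv_mul_le_iff₀ hρ]
    simpa [dist_eq_norm, f] using hη
  · rw [Real.norm_of_nonneg f.nonneg]
    exact f.le_one
  · refine closure_minimal (fun η hη => ?_) Metric.isClosed_closedBall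
    by_contra h
    refine hη (f.zero_of_le_dist ?_)
    rw [Metric.mem_closedBall, not_le, dist_eq_norm] at h
    rw [dist_zero_right, norm_smul, norm_inv, Real.norm_of_nonneg hρ.le, le_inv_mul_iff₀ hρ]
    show ρ * 2 ≤ _
    linarith
  · have h1 : HasFDerivAt (fun η : E => ρ⁻¹ • (η - p)) (ρ⁻¹ • ContinuousLinearMap.id ℝ E) η :=
      ((hasFDerivAt_id η).sub_const p).const_smul ρ⁻¹
    have h2 := ((cf.differentiable (by simp)) (ρ⁻¹ • (η - p))).hasFDerivAt.comp η h1
    have h3 : fderiv ℝ (fun η => f (ρ⁻¹ • (η - p))) η = _ := h2.fderiv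
    rw [h3, ContinuousLinearMap.comp_smul, ContinuousLinearMap.comp_id, norm_smul, norm_inv,
      Real.norm_of_nonneg hρ.le, div_eq_inv_mul]
    exact mul_le_mul_of_nonneg_left (hC _) (inv_nonneg.2 hρ.le)
  · have h1 := iteratedFDeriv_comp_sub (𝕜 := ℝ) (f := fun z : E => f (ρ⁻¹ • z)) m p η
    rw [h1]
    exact hM m _

/-- The first order Taylor remainder of `S` at `p`, cut off at scale `ρ`, has small gradient. -/
theorem exists_cutoff_remainder (E G : Type*) [NormedAddCommGroup E] [InnerProductSpace ℝ E]
    [FiniteDimensional ℝ E] [NormedAddCommGroup G] [NormedSpace ℝ G] {A δ : ℝ} (hA : 0 ≤ A)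
    (hδ : 0 < δ) {k : ℕ} (hk : 2 ≤ k) :
    ∃ ρ₀ : ℝ, 0 < ρ₀ ∧ ∀ ρ, 0 < ρ → ρ ≤ ρ₀ → ∃ B : ℝ, ∀ (S : E → G) (V : Set E) (p : E),
      IsOpen V → Metric.closedBall p (2 * ρ) ⊆ V → ContDiffOn ℝ ∞ S V →
      (∀ m ≤ k, ∀ ξ ∈ V, ‖iteratedFDeriv ℝ m S ξ‖ ≤ A) →
      ∃ h : E → G, ContDiff ℝ ∞ h ∧
        (∀ η ∈ Metric.closedBall p ρ, h η = S η - S p - fderiv ℝ S p (η - p)) ∧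
        (∀ η, ‖fderiv ℝ h η‖ ≤ δ) ∧ ∀ m ≤ k, ∀ η, ‖iteratedFDeriv ℝ m h η‖ ≤ B := by
  obtain ⟨C, hC0, hcut⟩ := exists_smooth_cutoff E
  have hden : 0 < A * (2 + 4 * C) + 1 := by positivity
  refine ⟨δ / (A * (2 + 4 * C) + 1), by positivity, fun ρ hρ hρ₀ => ?_⟩
  obtain ⟨M, hM⟩ := hcut ρ hρ
  set Q : ℝ := A + A * (2 * ρ) + A * (2 * ρ) * (2 * ρ) with hQ
  have hQ0 : 0 ≤ Q := by positivity
  refine ⟨∑ m ∈ Finset.range (k + 1), ∑ i ∈ Finset.range (m + 1), (m.choose i : ℝ) * |M i| * Q,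
    fun S V p hV hpV hS hSA => ?_⟩
  obtain ⟨χ, cχ, hχ1, hχle, hχs, hχ', hχM⟩ := hM p
  set L := fderiv ℝ S p with hL
  set r : E → G := fun η => S η - S p - L (η - p) with hr
  have hSat : ∀ η ∈ V, ContDiffAt ℝ ∞ S η := fun η hη => hS.contDiffAt (hV.mem_nhds hη)
  have crV : ContDiffOn ℝ ∞ r V :=
    (hS.sub contDiffOn_const).sub (L.contDiff.comp (contDiff_id.sub contDiff_const)).contDiffOn
  have dr : ∀ η ∈ V, HasFDerivAt r (fderiv ℝ S η - L) η := fun η hη =>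
    ((((hSat η hη).differentiableAt (by simp)).hasFDerivAt.sub_const (S p)).sub
      (L.hasFDerivAt.comp η ((hasFDerivAt_id η).sub_const p)))
  have hdr : ∀ η ∈ Metric.closedBall p (2 * ρ), ‖fderiv ℝ r η‖ ≤ A * (2 * ρ) := by
    intro η hη
    have h1 := (convex_closedBall p (2 * ρ)).norm_image_sub_le_of_norm_fderiv_le
      (f := fderiv ℝ S) (𝕜 := ℝ) (C := A) (x := p) (y := η)
      (fun x hx => ((hSat x (hpV hx)).fderiv_right (m := ∞) (by simp)).differentiableAt (by simp))
      (fun x hx => by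
        rw [← norm_iteratedFDeriv_one, norm_iteratedFDeriv_fderiv]
        exact hSA 2 hk x (hpV hx))
      (Metric.mem_closedBall_self (by positivity)) hη
    rw [(dr η (hpV hη)).fderiv]
    refine h1.trans (mul_le_mul_of_nonneg_left ?_ hA)
    rwa [← dist_eq_norm]
  have hr0 : ∀ η ∈ Metric.closedBall p (2 * ρ), ‖r η‖ ≤ A * (2 * ρ) * (2 * ρ) := by
    intro η hη
    have h1 := (convex_closedBall p (2 * ρ)).norm_image_sub_le_of_norm_fderiv_le
      (f := r) (𝕜 := ℝ) (x := p) (y := η) (fun x hx => (dr x (hpV hx)).differentiableAt) hdr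
      (Metric.mem_closedBall_self (by positivity)) hη
    have h2 : r p = 0 := by simp [hr]
    rw [h2, sub_zero] at h1
    refine h1.trans (mul_le_mul_of_nonneg_left ?_ (by positivity))
    rwa [← dist_eq_norm]
  have hrm : ∀ m ≤ k, ∀ η ∈ Metric.closedBall p (2 * ρ), ‖iteratedFDeriv ℝ m r η‖ ≤ Q := by
    intro m hm η hη
    rcases m with _ | _ | m
    · rw [norm_iteratedFDeriv_zero]
      exact (hr0 η hη).trans (le_add_of_nonneg_left (by positivity))
    · rw [zero_add, norm_iteratedFDeriv_one]
      refine (hdr η hη).trans ?_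
      rw [hQ]
      have : 0 ≤ A * (2 * ρ) * (2 * ρ) := by positivity
      linarith
    · rw [← norm_iteratedFDeriv_fderiv]
      have h1 : fderiv ℝ r =ᶠ[nhds η] fderiv ℝ S - fun _ => L := by
        filter_upwards [hV.mem_nhds (hpV hη)] with x hx using (dr x hx).fderiv
      rw [(h1.iteratedFDeriv ℝ (m + 1)).eq_of_nhds, iteratedFDeriv_sub_apply
        (((hSat η (hpV hη)).fderiv_right (m := ∞) (by simp)).of_le (by exact_mod_cast le_top))
        contDiffAt_const, iteratedFDeriv_const_of_ne (by omega), Pi.zero_apply, sub_zero,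
        norm_iteratedFDeriv_fderiv]
      refine (hSA _ hm η (hpV hη)).trans ?_
      rw [hQ, add_assoc]
      exact le_add_of_nonneg_right (by positivity)
  have hsup : tsupport (fun η => χ η • r η) ⊆ Metric.closedBall p (2 * ρ) :=
    (tsupport_smul_subset_left χ r).trans hχs
  have hB0 : ∀ m ≤ k, 0 ≤ ∑ i ∈ Finset.range (m + 1), (m.choose i : ℝ) * |M i| * Q :=
    fun m _ => Finset.sum_nonneg fun i _ => by positivity
  refine ⟨fun η => χ η • r η, contDiff_iff_contDiffAt.2 fun η => ?_, fun η hη => ?_, fun η => ?_,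
    fun m hm η => ?_⟩
  · by_cases hη : η ∈ tsupport fun η => χ η • r η
    · exact cχ.contDiffAt.smul (crV.contDiffAt (hV.mem_nhds (hpV (hsup hη))))
    · exact contDiffAt_const.congr_of_eventuallyEq (notMem_tsupport_iff_eventuallyEq.1 hη)
  · simp only [hχ1 η hη, one_smul, hr]
  · by_cases hη : η ∈ tsupport fun η => χ η • r η
    · have hηb := hsup hη
      rw [fderiv_fun_smul (cχ.differentiable (by simp) η) (dr η (hpV hηb)).differentiableAt]
      calc _ ≤ ‖χ η‖ * ‖fderiv ℝ r η‖ + ‖fderiv ℝ χ η‖ * ‖r η‖ := by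
            refine (norm_add_le _ _).trans (add_le_add (norm_smul _ _).le ?_)
            exact ContinuousLinearMap.norm_smulRight_apply _ _ |>.le
        _ ≤ 1 * (A * (2 * ρ)) + C / ρ * (A * (2 * ρ) * (2 * ρ)) := by
            gcongr
            · exact hχle η
            · exact hdr η hηb
            · exact hχ' η
            · exact hr0 η hηb
        _ = A * (2 + 4 * C) * ρ := by field_simp; ring
        _ ≤ (A * (2 + 4 * C) + 1) * ρ := by gcongr; linarith
        _ ≤ δ := by rwa [le_div_iff₀ hden, mul_comm] at hρ₀
    · have : fderiv ℝ (fun η => χ η • r η) η = 0 := by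
        by_contra h
        exact hη (support_fderiv_subset ℝ h)
      rw [this, norm_zero]
      exact hδ.le
  · refine le_trans ?_ (Finset.single_le_sum (f := fun m => ∑ i ∈ Finset.range (m + 1),
      (m.choose i : ℝ) * |M i| * Q) (fun m hm => hB0 m (by simpa [Nat.lt_succ_iff] using hm))
      (Finset.mem_range.2 (Nat.lt_succ_of_le hm)))
    by_cases hη : η ∈ tsupport fun η => χ η • r η
    · have hηb := hsup hη
      have h1 := norm_iteratedFDerivWithin_smul_le (n := m) (N := ∞) (cχ.contDiffOn (s := V)) crV
        hV.uniqueDiffOn (hpV hηb) (by exact_mod_cast le_top)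
      rw [iteratedFDerivWithin_of_isOpen m hV (hpV hηb)] at h1
      refine h1.trans (Finset.sum_le_sum fun i hi => ?_)
      rw [iteratedFDerivWithin_of_isOpen i hV (hpV hηb),
        iteratedFDerivWithin_of_isOpen (m - i) hV (hpV hηb)]
      gcongr
      · exact (hχM i η).trans (le_abs_self _)
      · exact hrm _ (by omega) η hηb
    · have : iteratedFDeriv ℝ m (fun η => χ η • r η) η = 0 := by
        by_contra h
        exact hη (support_iteratedFDeriv_subset m h)
      rw [this, norm_zero]
      exact hB0 m hm

end Remainder

section Geometry

open scoped Nat Matrix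

theorem exists_unit_orthogonal_range {E X : Type*} [NormedAddCommGroup E] [InnerProductSpace ℝ E]
    [FiniteDimensional ℝ E] [NormedAddCommGroup X] [InnerProductSpace ℝ X] [FiniteDimensional ℝ X]
    (h : Module.finrank ℝ E < Module.finrank ℝ X) (L : E →L[ℝ] X) :
    ∃ N : X, ‖N‖ = 1 ∧ ∀ v, inner ℝ (L v) N = 0 := by
  have h1 : (LinearMap.range L.toLinearMap)ᗮ ≠ ⊥ := by
    intro h0
    have h2 := Submodule.orthogonal_eq_bot_iff.1 h0
    have h3 := LinearMap.finrank_range_le L.toLinearMap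
    rw [h2, finrank_top] at h3
    omega
  obtain ⟨x, hx, hx0⟩ := Submodule.exists_mem_ne_zero_of_ne_bot h1
  refine ⟨(‖x‖⁻¹ : ℝ) • x, ?_, fun v => ?_⟩
  · rw [norm_smul, norm_inv, norm_norm, inv_mul_cancel₀ (norm_ne_zero_iff.2 hx0)]
  · have h2 : inner ℝ (L v) x = 0 :=
      Submodule.inner_right_of_mem_orthogonal (LinearMap.mem_range_self L.toLinearMap v) hx
    rw [inner_smul_right, h2, mul_zero]

theorem exists_preimage_of_inner_eq_zero {E X : Type*} [NormedAddCommGroup E]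
    [InnerProductSpace ℝ E] [FiniteDimensional ℝ E] [NormedAddCommGroup X] [InnerProductSpace ℝ X]
    [FiniteDimensional ℝ X] (h : Module.finrank ℝ X = Module.finrank ℝ E + 1) {L : E →L[ℝ] X}
    {lam : ℝ} (hlam : 0 < lam) (hL : ∀ v, lam * ‖v‖ ≤ ‖L v‖) {N : X} (hN : ‖N‖ = 1)
    (hLN : ∀ v, inner ℝ (L v) N = 0) {w : X} (hw : inner ℝ N w = 0) :
    ∃ v, L v = w ∧ ‖v‖ ≤ lam⁻¹ * ‖w‖ := by
  have hinj : Function.Injective L.toLinearMap := by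
    rw [injective_iff_map_eq_zero]
    intro v hv
    have h1 := hL v
    rw [show L v = 0 from hv, norm_zero] at h1
    exact norm_le_zero_iff.1 (nonpos_of_mul_nonpos_right h1 hlam)
  have hN0 : N ≠ 0 := fun h0 => by simp [h0] at hN
  have : Fact (Module.finrank ℝ X = Module.finrank ℝ E + 1) := ⟨h⟩
  have hr : LinearMap.range L.toLinearMap = (ℝ ∙ N)ᗮ := by
    refine Submodule.eq_of_le_of_finrank_eq ?_ ?_
    · rintro _ ⟨v, rfl⟩
      rw [Submodule.mem_orthogonal_singleton_iff_inner_left]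
      exact hLN v
    · rw [LinearMap.finrank_range_of_inj hinj, Submodule.finrank_orthogonal_span_singleton (n := Module.finrank ℝ E) hN0]
  have hw' : w ∈ (ℝ ∙ N)ᗮ := Submodule.mem_orthogonal_singleton_iff_inner_right.2 hw
  rw [← hr] at hw'
  obtain ⟨v, rfl⟩ := hw'
  refine ⟨v, rfl, ?_⟩
  rw [inv_mul_eq_div, le_div_iff₀ hlam, mul_comm]
  exact hL v

/-- The dual basis of unit vectors spanning a parallelepiped of volume at least `ν`. -/
theorem exists_dual_basis {m : ℕ} {ν : ℝ} (hν : 0 < ν) {N : Fin m → EuclideanSpace ℝ (Fin m)}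
    (hN : ∀ i, ‖N i‖ = 1) (hdet : ν ≤ |Matrix.det (Matrix.of fun i j => N i j)|) :
    ∃ Nd : Fin m → EuclideanSpace ℝ (Fin m),
      (∀ l j, inner ℝ (N l) (Nd j) = if l = j then (1 : ℝ) else 0) ∧
      (∀ j, ‖Nd j‖ ≤ m * (m ! / ν)) ∧
      ∀ x y, ∑ l, inner ℝ x (Nd l) * inner ℝ (N l) y = (inner ℝ x y : ℝ) := by
  set M : Matrix (Fin m) (Fin m) ℝ := Matrix.of fun i j => N i j with hM
  have hu : IsUnit M.det := by
    rw [isUnit_iff_ne_zero]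
    intro h0
    rw [h0, abs_zero] at hdet
    linarith
  have hMle : ∀ i j, |M i j| ≤ 1 := fun i j => by
    rw [← hN i, ← Real.norm_eq_abs]
    exact PiLp.norm_apply_le (N i) j
  have hadj : ∀ i j, |M.adjugate i j| ≤ m ! := by
    intro i j
    rw [Matrix.adjugate_apply]
    have h1 := Matrix.det_le (A := M.updateRow j (Pi.single i 1)) (abv := AbsoluteValue.abs)
      (x := (1 : ℝ)) (fun a b => by
        rw [AbsoluteValue.abs_apply, Matrix.updateRow_apply]
        split_ifs
        · by_cases hb : b = i
          · simp [hb]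
          · simp [Pi.single_eq_of_ne hb]
        · exact hMle a b)
    simpa using h1
  have hinv : ∀ i j, |M⁻¹ i j| ≤ m ! / ν := by
    intro i j
    rw [Matrix.inv_def, Matrix.smul_apply, smul_eq_mul, abs_mul, Ring.inverse_eq_inv', abs_inv,
      inv_mul_eq_div]
    exact div_le_div₀ (by positivity) (hadj i j) hν hdet
  have hin : ∀ x y : EuclideanSpace ℝ (Fin m), (inner ℝ x y : ℝ) = ∑ i, x i * y i := fun x y => by
    rw [PiLp.inner_apply]
    exact Finset.sum_congr rfl fun i _ => by simp [mul_comm]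
  refine ⟨fun j => WithLp.toLp 2 fun i => M⁻¹ i j, fun l j => ?_, fun j => ?_, fun x y => ?_⟩
  · rw [hin]
    have h1 := congrFun (congrFun (Matrix.mul_nonsing_inv M hu) l) j
    rw [Matrix.mul_apply, Matrix.one_apply] at h1
    exact h1
  · rw [EuclideanSpace.norm_eq]
    refine Real.sqrt_le_iff.2 ⟨by positivity, ?_⟩
    refine (Finset.sum_sq_le_sq_sum_of_nonneg fun i _ => norm_nonneg _).trans ?_
    refine pow_le_pow_left₀ (Finset.sum_nonneg fun i _ => norm_nonneg _) ?_ 2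
    refine (Finset.sum_le_card_nsmul _ _ (m ! / ν) fun i _ => hinv i j).trans ?_
    simp
  · have h1 : ∀ l, (inner ℝ x (WithLp.toLp 2 fun i => M⁻¹ i l) : ℝ) = (x.ofLp ᵥ* M⁻¹) l :=
      fun l => by rw [hin]; rfl
    have h2 : ∀ l, (inner ℝ (N l) y : ℝ) = (M *ᵥ y.ofLp) l := fun l => by rw [hin]; rfl
    simp only [h1, h2]
    have h3 : (x.ofLp ᵥ* M⁻¹) ⬝ᵥ (M *ᵥ y.ofLp) = x.ofLp ⬝ᵥ y.ofLp := by
      rw [Matrix.dotProduct_mulVec, Matrix.vecMul_vecMul, Matrix.nonsing_inv_mul M hu,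
        Matrix.vecMul_one]
    rw [hin]
    exact h3

/-- Linear coordinates adapted to transversal hypersurfaces, in which the hypersurfaces are small
perturbations of the coordinate hyperplanes near the given points. -/
theorem exists_nearCoord (n : ℕ) {A lam ν δ : ℝ} (hA : 0 ≤ A) (hlam : 0 < lam) (hν : 0 < ν)
    (hδ : 0 < δ) : ∃ ρ₀ : ℝ, 0 < ρ₀ ∧ ∀ ρ, 0 < ρ → ρ ≤ ρ₀ → ∃ B : ℝ,
    ∀ (S : Fin (n + 2) → EuclideanSpace ℝ (Fin (n + 1)) → EuclideanSpace ℝ (Fin (n + 2)))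
      (V : Fin (n + 2) → Set (EuclideanSpace ℝ (Fin (n + 1))))
      (p : Fin (n + 2) → EuclideanSpace ℝ (Fin (n + 1))),
      (∀ i, IsOpen (V i)) → (∀ i, Metric.closedBall (p i) (2 * ρ) ⊆ V i) →
      (∀ i, ContDiffOn ℝ ∞ (S i) (V i)) →
      (∀ i, ∀ m ≤ n + 2, ∀ ξ ∈ V i, ‖iteratedFDeriv ℝ m (S i) ξ‖ ≤ A) →
      (∀ i v, lam * ‖v‖ ≤ ‖fderiv ℝ (S i) (p i) v‖) →
      (∀ N : Fin (n + 2) → EuclideanSpace ℝ (Fin (n + 2)),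
        (∀ i, IsUnitNormal (S i) (p i) (N i)) →
          ν ≤ |Matrix.det (Matrix.of fun i j => N i j)|) →
      ∃ (σ : EuclideanSpace ℝ (Fin (n + 2)) →L[ℝ] Fin (n + 2) → ℝ)
        (v : Fin (n + 2) → Fin (n + 1) → EuclideanSpace ℝ (Fin (n + 1)))
        (Θ : Fin (n + 2) → EuclideanSpace ℝ (Fin (n + 1)) → Fin (n + 2) → ℝ)
        (c : Fin (n + 2) → EuclideanSpace ℝ (Fin (n + 2))),
        Function.Surjective σ ∧
        (∀ x, ‖σ x‖ ≤ ((n + 2 : ℕ) * ((n + 2)! / ν)) * ‖x‖) ∧ (∀ x, ‖x‖ ≤ (n + 2) * ‖σ x‖) ∧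
        (∀ i, NearCoord i δ B (v i) (Θ i)) ∧
        ∀ i, ∀ η ∈ Metric.closedBall (p i) ρ, ∀ x,
          ∑ l, σ x l * Θ i η l = inner ℝ x (S i η) + inner ℝ x (c i) := by
  set Cν : ℝ := (n + 2 : ℕ) * ((n + 2)! / ν) with hCν
  have hCν0 : 0 ≤ Cν := by positivity
  set b : ℝ := lam⁻¹ * Cν + 1 with hb
  have hb1 : 1 ≤ b := by rw [hb]; exact le_add_of_nonneg_left (by positivity)
  have hb0 : 0 < b := by linarith
  obtain ⟨ρ₀, hρ₀, hrem⟩ := exists_cutoff_remainder (EuclideanSpace ℝ (Fin (n + 1)))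
    (EuclideanSpace ℝ (Fin (n + 2))) hA (div_pos hδ hb0) (k := n + 2) (by omega)
  refine ⟨ρ₀, hρ₀, fun ρ hρ hρle => ?_⟩
  obtain ⟨B, hB⟩ := hrem ρ hρ hρle
  refine ⟨max b (b ^ (n + 1) * (b * B)), fun S V p hV hpV hS hSA hSlam hdet => ?_⟩
  have hfin : Module.finrank ℝ (EuclideanSpace ℝ (Fin (n + 2))) =
      Module.finrank ℝ (EuclideanSpace ℝ (Fin (n + 1))) + 1 := by simp
  choose N hN1 hN using fun i => exists_unit_orthogonal_range (by omega) (fderiv ℝ (S i) (p i))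
  obtain ⟨Nd, hNd, hNdC, hNx⟩ := exists_dual_basis hν hN1 (hdet N fun i => ⟨hN1 i, hN i⟩)
  choose v hv hvle using fun (i : Fin (n + 2)) (j : Fin (n + 1)) =>
    exists_preimage_of_inner_eq_zero hfin hlam (hSlam i) (hN1 i) (hN i) (w := Nd (i.succAbove j))
      (by rw [hNd, if_neg (Fin.succAbove_ne i j).symm])
  choose h hhc hh hhδ hhB using fun i => hB (S i) (V i) (p i) (hV i) (hpV i) (hS i) (hSA i)
  have hvb : ∀ i j, ‖v i j‖ ≤ b := fun i j => by
    refine (hvle i j).trans ?_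
    have := mul_le_mul_of_nonneg_left (hNdC (i.succAbove j)) (inv_nonneg.2 hlam.le)
    rw [hb]
    linarith
  have hcoord : ∀ x : EuclideanSpace ℝ (Fin (n + 2)), ∀ l,
      |inner ℝ x (Nd l)| ≤ Cν * ‖x‖ := fun x l => by
    refine (abs_real_inner_le_norm _ _).trans ?_
    rw [mul_comm]
    exact mul_le_mul_of_nonneg_right (hNdC l) (norm_nonneg _)
  set σ : EuclideanSpace ℝ (Fin (n + 2)) →L[ℝ] Fin (n + 2) → ℝ :=
    ContinuousLinearMap.pi fun l => innerSL ℝ (Nd l) with hσ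
  have hσl : ∀ x l, σ x l = inner ℝ x (Nd l) := fun x l => by
    rw [real_inner_comm]
    rfl
  set T : Fin (n + 2) → EuclideanSpace ℝ (Fin (n + 1)) → EuclideanSpace ℝ (Fin (n + 2)) :=
    fun i η => fderiv ℝ (S i) (p i) η + h i η with hT
  have hTc : ∀ i, ContDiff ℝ ∞ (T i) := fun i => (fderiv ℝ (S i) (p i)).contDiff.add (hhc i)
  have hd : ∀ i l η j, fderiv ℝ (fun η => (inner ℝ (N l) (T i η) : ℝ)) η (v i j) -
      (if l = i.succAbove j then (1 : ℝ) else 0) = inner ℝ (N l) (fderiv ℝ (h i) η (v i j)) := by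
    intro i l η j
    have h1 : HasFDerivAt (T i) (fderiv ℝ (S i) (p i) + fderiv ℝ (h i) η) η :=
      (fderiv ℝ (S i) (p i)).hasFDerivAt.add ((hhc i).differentiable (by simp) η).hasFDerivAt
    have h2 := (innerSL ℝ (N l)).hasFDerivAt.comp η h1
    have h3 : fderiv ℝ (fun η => (inner ℝ (N l) (T i η) : ℝ)) η = _ := h2.fderiv
    rw [h3, ContinuousLinearMap.comp_apply, _root_.add_apply, hv, innerSL_apply_apply,
      inner_add_right, hNd, add_sub_cancel_left]
  refine ⟨σ, v, fun i η l => inner ℝ (N l) (T i η),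
    fun i => fderiv ℝ (S i) (p i) (p i) - S i (p i), fun s => ⟨∑ l, s l • N l, ?_⟩, fun x => ?_,
    fun x => ?_, fun i => ⟨?_, fun j => (hvb i j).trans (le_max_left _ _), fun j l η => ?_,
    fun j l => ?_⟩, fun i η hη x => ?_⟩
  · ext j
    rw [hσl, sum_inner]
    simp [inner_smul_left, hNd]
  · refine (pi_norm_le_iff_of_nonneg (by positivity)).2 fun l => ?_
    rw [hσl]
    exact hcoord x l
  · have h1 : x = ∑ l, σ x l • N l := by
      refine ext_inner_right ℝ fun y => ?_
      rw [sum_inner, ← hNx]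
      exact Finset.sum_congr rfl fun l _ => by rw [inner_smul_left, hσl]; rfl
    calc ‖x‖ ≤ ∑ l, ‖σ x l • N l‖ := by
          conv_lhs => rw [h1]
          exact norm_sum_le _ _
      _ ≤ ∑ l : Fin (n + 2), ‖σ x‖ := Finset.sum_le_sum fun l _ => by
          rw [norm_smul, hN1, mul_one]
          exact norm_le_pi_norm _ l
      _ = _ := by simp
  · exact contDiff_pi.2 fun l => (innerSL ℝ (N l)).contDiff.comp (hTc i)
  · rw [hd]
    refine (abs_real_inner_le_norm _ _).trans ?_
    rw [hN1, one_mul]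
    refine ((fderiv ℝ (h i) η).le_opNorm _).trans ?_
    calc _ ≤ δ / b * b := mul_le_mul (hhδ i η) (hvb i j) (norm_nonneg _) (by positivity)
      _ = δ := div_mul_cancel₀ _ hb0.ne'
  · simp only [hd]
    set P : (EuclideanSpace ℝ (Fin (n + 1)) →L[ℝ] EuclideanSpace ℝ (Fin (n + 2))) →L[ℝ] ℝ :=
      (innerSL ℝ (N l)).comp (ContinuousLinearMap.apply ℝ _ (v i j)) with hP
    have hPn : ‖P‖ ≤ b := by
      refine ContinuousLinearMap.opNorm_le_bound _ hb0.le fun L => ?_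
      refine (abs_real_inner_le_norm (N l) (L (v i j))).trans ?_
      rw [hN1, one_mul, mul_comm]
      exact (L.le_opNorm _).trans (mul_le_mul_of_nonneg_left (hvb i j) (norm_nonneg _))
    have hc : ContDiff ℝ ∞ (fderiv ℝ (h i)) := (hhc i).fderiv_right (m := ∞) (by simp)
    refine (DirBound.of_norm_iteratedFDeriv_le (f := fun η => P (fderiv ℝ (h i) η)) hb1 (hvb i)
      (P.contDiff.comp hc) (M := b * B) fun m hm η => ?_).mono_const (le_max_right _ _)
    have h2 := P.norm_iteratedFDeriv_comp_left (x := η) (n := m) (N := ∞) hc.contDiffAt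
      (by exact_mod_cast le_top)
    rw [norm_iteratedFDeriv_fderiv] at h2
    exact h2.trans (mul_le_mul hPn (hhB i _ (by omega) η) (norm_nonneg _) hb0.le)
  · simp only [hσl]
    rw [hNx, ← inner_add_right]
    congr 1
    simp only [hT]
    rw [hh i η hη, map_sub]
    abel

end Geometry

section Globalization

open scoped Nat

theorem exists_finite_measurable_partition {E : Type*} [PseudoMetricSpace E] [MeasurableSpace E]
    [OpensMeasurableSpace E] {U : Set E} (hU : MeasurableSet U) (hUb : TotallyBounded U) {ρ : ℝ}
    (hρ : 0 < ρ) : ∃ (N : ℕ) (Z : Fin N → Set E) (q : Fin N → E), (∀ k, MeasurableSet (Z k)) ∧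
      Pairwise (Function.onFun Disjoint Z) ∧ ⋃ k, Z k = U ∧
      ∀ k, q k ∈ U ∧ Z k ⊆ Metric.closedBall (q k) ρ := by
  obtain ⟨t, htU, htf, ht⟩ := Metric.finite_approx_of_totallyBounded hUb ρ hρ
  obtain ⟨N, q, rfl⟩ := htf.fin_embedding
  refine ⟨N, disjointed fun k => U ∩ Metric.ball (q k) ρ, q, fun k => ?_, disjoint_disjointed _, ?_,
    fun k => ⟨htU ⟨k, rfl⟩, (disjointed_subset _ k).trans
      (inter_subset_right.trans Metric.ball_subset_closedBall)⟩⟩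
  · have hm : ∀ k, MeasurableSet (U ∩ Metric.ball (q k) ρ) :=
      fun k => hU.inter Metric.isOpen_ball.measurableSet
    exact disjointedRec (fun _ _ ht => ht.diff (hm _)) (hm k)
  · rw [iUnion_disjointed, ← inter_iUnion, inter_eq_left]
    simpa using ht

theorem norm_exp_I_mul_mul (a : ℝ) (z : ℂ) : ‖Complex.exp (Complex.I * (a : ℂ)) * z‖ = ‖z‖ := by
  rw [norm_mul, norm_exp_I_mul_ofReal, one_mul]

variable {n : ℕ} {S : EuclideanSpace ℝ (Fin n) → EuclideanSpace ℝ (Fin (n + 1))}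
  {Z : Set (EuclideanSpace ℝ (Fin n))} {f : EuclideanSpace ℝ (Fin n) → ℂ}

theorem aestronglyMeasurable_exp_inner (hS : AEStronglyMeasurable S (volume.restrict Z))
    (x : EuclideanSpace ℝ (Fin (n + 1))) :
    AEStronglyMeasurable (fun ξ => Complex.exp (Complex.I * ((inner ℝ x (S ξ) : ℝ) : ℂ)))
      (volume.restrict Z) :=
  (show Continuous fun y : EuclideanSpace ℝ (Fin (n + 1)) =>
    Complex.exp (Complex.I * ((inner ℝ x y : ℝ) : ℂ)) by fun_prop).comp_aestronglyMeasurable hS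

theorem integrableOn_exp_inner_mul (hS : AEStronglyMeasurable S (volume.restrict Z))
    (hf : IntegrableOn f Z) (x : EuclideanSpace ℝ (Fin (n + 1))) :
    IntegrableOn (fun ξ => Complex.exp (Complex.I * ((inner ℝ x (S ξ) : ℝ) : ℂ)) * f ξ) Z :=
  Integrable.bdd_mul hf (aestronglyMeasurable_exp_inner hS x)
    (Filter.Eventually.of_forall fun _ => (norm_exp_I_mul_ofReal _).le)

theorem continuous_extensionOp (hS : AEStronglyMeasurable S (volume.restrict Z))
    (hf : IntegrableOn f Z) : Continuous (extensionOp Z S f) := by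
  refine continuous_of_dominated (bound := fun ξ => ‖f ξ‖) (fun x =>
    (integrableOn_exp_inner_mul hS hf x).1) (fun x => Filter.Eventually.of_forall
      fun ξ => (norm_exp_I_mul_mul _ _).le) hf.norm (Filter.Eventually.of_forall fun ξ => ?_)
  fun_prop

theorem extensionOp_iUnion {N : ℕ} {W : Fin N → Set (EuclideanSpace ℝ (Fin n))}
    (hW : ∀ k, MeasurableSet (W k)) (hd : Pairwise (Function.onFun Disjoint W))
    (hZ : ⋃ k, W k = Z) (hS : AEStronglyMeasurable S (volume.restrict Z))
    (hf : IntegrableOn f Z) (x : EuclideanSpace ℝ (Fin (n + 1))) :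
    extensionOp Z S f x = ∑ k, extensionOp (W k) S f x := by
  subst hZ
  exact integral_iUnion_fintype hW hd fun k =>
    (integrableOn_exp_inner_mul hS hf x).mono_set (subset_iUnion W k)

theorem enorm_extensionOp_eq_enorm_oscOp (hZ : MeasurableSet Z)
    {x : EuclideanSpace ℝ (Fin (n + 1))} {Θ : EuclideanSpace ℝ (Fin n) → Fin (n + 1) → ℝ}
    {s : Fin (n + 1) → ℝ} {a : ℝ} (h : ∀ η ∈ Z, ∑ l, s l * Θ η l = inner ℝ x (S η) + a) :
    ‖extensionOp Z S f x‖ₑ =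
      ‖oscOp Θ (Z.indicator fun η => ((decayWeight η)⁻¹ : ℂ) * f η) s‖ₑ := by
  have h1 : oscOp Θ (Z.indicator fun η => ((decayWeight η)⁻¹ : ℂ) * f η) s =
      Complex.exp (Complex.I * (a : ℂ)) * extensionOp Z S f x := by
    unfold oscOp extensionOp
    rw [← integral_const_mul, ← integral_indicator hZ]
    refine integral_congr_ae (Filter.Eventually.of_forall fun η => ?_)
    by_cases hη : η ∈ Z
    · have h2 : (decayWeight η : ℂ) ≠ 0 := by exact_mod_cast (decayWeight_pos η).ne'
      simp only [indicator_of_mem hη]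
      rw [h η hη, ← mul_assoc (Complex.exp (Complex.I * (a : ℂ))), ← Complex.exp_add, mul_assoc,
        mul_inv_cancel_left₀ h2]
      push_cast
      congr 2
      ring
    · simp only [indicator_of_notMem hη, mul_zero]
  rw [h1, enorm_mul, ← ofReal_norm (Complex.exp _), norm_exp_I_mul_ofReal, ENNReal.ofReal_one,
    one_mul]

theorem norm_inv_decayWeight_mul_le {E : Type*} [NormedAddCommGroup E] [InnerProductSpace ℝ E]
    [FiniteDimensional ℝ E] [MeasurableSpace E] [BorelSpace E] {r : ℝ} {η : E} (hη : η ∈ Metric.closedBall 0 r) (z : ℂ) :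
    ‖((decayWeight η)⁻¹ : ℂ) * z‖ ≤ (1 + r ^ 2) ^ (Module.finrank ℝ E + 1) * ‖z‖ := by
  rw [norm_mul, norm_inv, Complex.norm_real, Real.norm_of_nonneg (decayWeight_pos η).le,
    decayWeight, inv_inv]
  have := mem_closedBall_zero_iff.1 hη
  gcongr

theorem continuous_inv_decayWeight {E : Type*} [NormedAddCommGroup E] [InnerProductSpace ℝ E]
    [FiniteDimensional ℝ E] [MeasurableSpace E] [BorelSpace E] :
    Continuous fun η : E => ((decayWeight η)⁻¹ : ℂ) :=
  (Complex.continuous_ofReal.comp contDiff_decayWeight.continuous).inv₀ fun η =>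
    Complex.ofReal_ne_zero.2 (decayWeight_pos η).ne'

theorem memLp_indicator_inv_decayWeight_mul (hZ : MeasurableSet Z) {r : ℝ}
    (hZr : Z ⊆ Metric.closedBall 0 r) (hf : MemLp f 2 (volume.restrict Z)) :
    MemLp (Z.indicator fun η => ((decayWeight η)⁻¹ : ℂ) * f η) 2 volume ∧
      eLpNorm (Z.indicator fun η => ((decayWeight η)⁻¹ : ℂ) * f η) 2 volume ≤
        ENNReal.ofReal ((1 + r ^ 2) ^ (n + 1)) * eLpNorm f 2 (volume.restrict Z) := by
  have h1 : ∀ᵐ η ∂volume.restrict Z,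
      ‖((decayWeight η)⁻¹ : ℂ) * f η‖ ≤ (1 + r ^ 2) ^ (n + 1) * ‖f η‖ := by
    filter_upwards [ae_restrict_mem hZ] with η hη
    have h2 := norm_inv_decayWeight_mul_le (hZr hη) (f η)
    rwa [finrank_euclideanSpace_fin] at h2
  rw [memLp_indicator_iff_restrict hZ, eLpNorm_indicator_eq_eLpNorm_restrict hZ]
  exact ⟨hf.of_le_mul (continuous_inv_decayWeight.aestronglyMeasurable.mul hf.1) h1,
    eLpNorm_le_mul_eLpNorm_of_ae_le_mul h1 2⟩

/-- The multilinear extension estimate for small pieces of transversal hypersurfaces. -/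
theorem exists_lintegral_prod_extensionOp_le (n : ℕ) {A lam ν ε r : ℝ} (hA : 0 ≤ A)
    (hlam : 0 < lam) (hν : 0 < ν) (hε : 0 < ε) : ∃ ρ₀ : ℝ, 0 < ρ₀ ∧ ∀ ρ, 0 < ρ → ρ ≤ ρ₀ →
    ∃ C : ℝ≥0,
    ∀ (S : Fin (n + 2) → EuclideanSpace ℝ (Fin (n + 1)) → EuclideanSpace ℝ (Fin (n + 2)))
      (V : Fin (n + 2) → Set (EuclideanSpace ℝ (Fin (n + 1))))
      (p : Fin (n + 2) → EuclideanSpace ℝ (Fin (n + 1)))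
      (Z : Fin (n + 2) → Set (EuclideanSpace ℝ (Fin (n + 1)))),
      (∀ i, IsOpen (V i)) → (∀ i, Metric.closedBall (p i) (2 * ρ) ⊆ V i) →
      (∀ i, ContDiffOn ℝ ∞ (S i) (V i)) →
      (∀ i, ∀ m ≤ n + 2, ∀ ξ ∈ V i, ‖iteratedFDeriv ℝ m (S i) ξ‖ ≤ A) →
      (∀ i v, lam * ‖v‖ ≤ ‖fderiv ℝ (S i) (p i) v‖) →
      (∀ N : Fin (n + 2) → EuclideanSpace ℝ (Fin (n + 2)),
        (∀ i, IsUnitNormal (S i) (p i) (N i)) →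
          ν ≤ |Matrix.det (Matrix.of fun i j => N i j)|) →
      (∀ i, MeasurableSet (Z i)) → (∀ i, Z i ⊆ Metric.closedBall (p i) ρ) →
      (∀ i, Z i ⊆ Metric.closedBall 0 r) → ∀ R, 1 ≤ R →
      ∀ f : Fin (n + 2) → EuclideanSpace ℝ (Fin (n + 1)) → ℂ,
      (∀ i, MemLp (f i) 2 (volume.restrict (Z i))) →
        ∫⁻ x in Metric.ball 0 R,
            ∏ i, ‖extensionOp (Z i) (S i) (f i) x‖ₑ ^ (2 / ((n + 1 : ℕ) : ℝ)) ≤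
          C * ENNReal.ofReal (R ^ ε) *
            ∏ i, eLpNorm (f i) 2 (volume.restrict (Z i)) ^ (2 / ((n + 1 : ℕ) : ℝ)) := by
  set p' : ℝ := 2 / ((n + 1 : ℕ) : ℝ) with hp'
  have hp0 : 0 ≤ p' := by positivity
  obtain ⟨δ, hδ, hmodel⟩ := exists_multBound (EuclideanSpace ℝ (Fin (n + 1))) n hε
  obtain ⟨ρ₀, hρ₀, hcoord⟩ := exists_nearCoord n hA hlam hν hδ
  refine ⟨ρ₀, hρ₀, fun ρ hρ hρle => ?_⟩
  obtain ⟨B, hB⟩ := hcoord ρ hρ hρle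
  obtain ⟨R₀, C, hC⟩ := hmodel B
  set b : ℝ := (n + 2 : ℕ) * ((n + 2)! / ν) + 1 with hb
  have hb1 : 1 ≤ b := le_add_of_nonneg_left (by positivity)
  have hb0 : 0 < b := by linarith
  set w : ℝ≥0∞ := volume (Metric.closedBall (0 : EuclideanSpace ℝ (Fin (n + 2))) ((n + 2) * R₀))
    with hw
  set a : ℝ≥0∞ := ENNReal.ofReal ((1 + r ^ 2) ^ (n + 1 + 1)) with ha
  set D : ℝ≥0∞ := C * w * ENNReal.ofReal (b ^ ε) * (a ^ p') ^ (n + 2) with hD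
  have hDtop : D ≠ ⊤ := by
    refine ENNReal.mul_ne_top (ENNReal.mul_ne_top (ENNReal.mul_ne_top ENNReal.coe_ne_top
      measure_closedBall_lt_top.ne) ENNReal.ofReal_ne_top) (ENNReal.pow_ne_top ?_)
    exact ENNReal.rpow_ne_top_of_nonneg hp0 ENNReal.ofReal_ne_top
  refine ⟨D.toNNReal, fun S V p Z hV hpV hS hSA hSlam hdet hZ hZp hZr R hR f hf => ?_⟩
  rw [ENNReal.coe_toNNReal hDtop]
  obtain ⟨σ, v, Θ, c, hσ, hσle, hleσ, hΘ, hphase⟩ := hB S V p hV hpV hS hSA hSlam hdet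
  have hσm : Measurable σ := σ.continuous.measurable
  set μ : Measure (Fin (n + 2) → ℝ) := Measure.map σ volume with hμ
  have : μ.IsAddLeftInvariant :=
    isAddLeftInvariant_map (σ.toLinearMap.toAddMonoidHom.toAddHom) hσm hσ
  set F : Fin (n + 2) → EuclideanSpace ℝ (Fin (n + 1)) → ℂ :=
    fun i => (Z i).indicator fun η => ((decayWeight η)⁻¹ : ℂ) * f i η with hF
  have hFm := fun i => memLp_indicator_inv_decayWeight_mul (hZ i) (hZr i) (hf i)
  have hR0 : 0 < R := by linarith
  have hbR : 1 ≤ b * R := one_le_mul_of_one_le_of_one_le hb1 hR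
  have hμw : μ (Metric.ball 0 R₀) ≤ w := by
    rw [hμ, Measure.map_apply hσm Metric.isOpen_ball.measurableSet]
    refine measure_mono fun x hx => ?_
    rw [mem_preimage, mem_ball_zero_iff] at hx
    rw [mem_closedBall_zero_iff]
    exact (hleσ x).trans (by gcongr)
  have hmeas : Measurable fun s => ∏ i, ‖oscOp (Θ i) (F i) s‖ₑ ^ p' :=
    Finset.measurable_prod _ fun i _ =>
      ((continuous_oscOp (hΘ i).contDiff (hFm i).1).enorm.measurable).pow_const _
  calc ∫⁻ x in Metric.ball 0 R, ∏ i, ‖extensionOp (Z i) (S i) (f i) x‖ₑ ^ p'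
      = ∫⁻ x in Metric.ball 0 R, ∏ i, ‖oscOp (Θ i) (F i) (σ x)‖ₑ ^ p' := by
        refine lintegral_congr fun x => Finset.prod_congr rfl fun i _ => ?_
        rw [enorm_extensionOp_eq_enorm_oscOp (hZ i) fun η hη => hphase i η (hZp i hη) x]
    _ ≤ ∫⁻ x in σ ⁻¹' Metric.ball 0 (b * R), ∏ i, ‖oscOp (Θ i) (F i) (σ x)‖ₑ ^ p' := by
        refine lintegral_mono_set fun x hx => ?_
        rw [mem_ball_zero_iff] at hx
        rw [mem_preimage, mem_ball_zero_iff]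
        have h1 := hσle x
        have h2 : b * ‖x‖ < b * R := by gcongr
        rw [hb, add_mul, one_mul] at h2
        rw [hb]
        linarith [norm_nonneg x]
    _ = ∫⁻ s in Metric.ball 0 (b * R), ∏ i, ‖oscOp (Θ i) (F i) s‖ₑ ^ p' ∂μ :=
        (setLIntegral_map Metric.isOpen_ball.measurableSet hmeas hσm).symm
    _ ≤ _ := hC μ Θ v hΘ (b * R) hbR F fun i => (hFm i).1
    _ ≤ C * w * ENNReal.ofReal ((b * R) ^ ε) *
          ∏ i, (a * eLpNorm (f i) 2 (volume.restrict (Z i))) ^ p' := by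
        gcongr with i
        exact (hFm i).2
    _ = _ := by
        simp only [ENNReal.mul_rpow_of_nonneg _ _ hp0]
        rw [Finset.prod_mul_distrib, Finset.prod_const, Finset.card_univ, Fintype.card_fin,
          Real.mul_rpow hb0.le hR0.le, ENNReal.ofReal_mul (by positivity), hD]
        ring

end Globalization

section MainTheorem

/-- A radius at which all balls centred in `U i` lie well inside `V i`. -/
theorem exists_radius_closedBall_subset {ι E : Type*} [Finite ι] [PseudoMetricSpace E]
    [ProperSpace E] {U V : ι → Set E} (hU : ∀ i, Bornology.IsBounded (U i))
    (hV : ∀ i, IsOpen (V i)) (hUV : ∀ i, closure (U i) ⊆ V i) {ρ₀ : ℝ} (hρ₀ : 0 < ρ₀) :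
    ∃ ρ, 0 < ρ ∧ ρ ≤ ρ₀ ∧ ∀ i, ∀ q ∈ U i, Metric.closedBall q (2 * ρ) ⊆ V i := by
  choose δ hδ hδV using fun i =>
    (hU i).isCompact_closure.exists_cthickening_subset_open (hV i) (hUV i)
  have h1 : ∀ᶠ ρ in nhdsWithin (0 : ℝ) (Ioi 0), ρ ∈ Ioc 0 ρ₀ ∧ ∀ i, ρ ∈ Ioc 0 (δ i / 2) :=
    (Filter.eventually_mem_set.2 (Ioc_mem_nhdsGT hρ₀)).and
      (Filter.eventually_all.2 fun i => Ioc_mem_nhdsGT (half_pos (hδ i)))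
  obtain ⟨ρ, h2, h3⟩ := h1.exists
  refine ⟨ρ, h2.1, h2.2, fun i q hq => ?_⟩
  refine ((Metric.closedBall_subset_closedBall ?_).trans
    (Metric.closedBall_subset_cthickening (subset_closure hq) (δ i))).trans (hδV i)
  linarith [(h3 i).2]

theorem mainTheorem1 (n : ℕ) (hn : 1 ≤ n) :
    ∃ K : ℕ,
      ∀ U V : Fin (n + 1) → Set (EuclideanSpace ℝ (Fin n)),
      (∀ i, IsOpen (U i)) → (∀ i, Bornology.IsBounded (U i)) →
      (∀ i, IsOpen (V i)) → (∀ i, closure (U i) ⊆ V i) →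
      ∀ A lam ν ε : ℝ, 0 < lam → 0 < ν → 0 < ε →
      ∃ C : ℝ≥0,
        ∀ S : Fin (n + 1) → EuclideanSpace ℝ (Fin n) → EuclideanSpace ℝ (Fin (n + 1)),
        (∀ i, ContDiffOn ℝ ∞ (S i) (V i)) →
        (∀ i, ∀ k ≤ K, ∀ ξ ∈ V i, ‖iteratedFDeriv ℝ k (S i) ξ‖ ≤ A) →
        (∀ i, ∀ ξ ∈ U i, ∀ v, lam * ‖v‖ ≤ ‖fderiv ℝ (S i) ξ v‖) →
        TransversalWith U S ν →
        ∀ R : ℝ, 1 ≤ R →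
        ∀ f : Fin (n + 1) → EuclideanSpace ℝ (Fin n) → ℂ,
        (∀ i, MemLp (f i) 2 (volume.restrict (U i))) →
          eLpNorm (fun x => ∏ i, extensionOp (U i) (S i) (f i) x) (ENNReal.ofReal (2 / (n : ℝ)))
              (volume.restrict (Metric.ball 0 R))
            ≤ (C : ℝ≥0∞) * ENNReal.ofReal (R ^ ε) *
              ∏ i, eLpNorm (f i) 2 (volume.restrict (U i)) := by
  obtain ⟨n, rfl⟩ := Nat.exists_eq_add_of_le' hn
  refine ⟨n + 2, fun U V hUo hUb hVo hUV A lam ν ε hlam hν hε => ?_⟩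
  set p : ℝ := 2 / ((n + 1 : ℕ) : ℝ) with hp
  have hp0 : 0 < p := by positivity
  obtain ⟨r, hr⟩ := (Bornology.isBounded_iUnion.2 hUb).subset_closedBall 0
  obtain ⟨ρ₀, hρ₀, hloc⟩ := exists_lintegral_prod_extensionOp_le n (A := max A 0) (r := r)
    (le_max_right _ _) hlam hν (mul_pos hp0 hε)
  obtain ⟨ρ, hρ, hρle, hρV⟩ := exists_radius_closedBall_subset hUb hVo hUV hρ₀
  obtain ⟨C, hC⟩ := hloc ρ hρ hρle
  choose N Z q hZm hZd hZU hqZ using fun i =>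
    exists_finite_measurable_partition (hUo i).measurableSet
      ((hUb i).isCompact_closure.totallyBounded.subset subset_closure) hρ
  set M : ℕ := ∑ i, N i with hM
  set k₁ : ℝ≥0∞ := ((M : ℝ≥0∞) ^ p) ^ (n + 2) with hk₁
  have hk₁top : k₁ ≠ ⊤ := ENNReal.pow_ne_top
    (ENNReal.rpow_ne_top_of_nonneg hp0.le (ENNReal.natCast_ne_top M))
  set D : ℝ≥0∞ := k₁ * (Fintype.card (∀ i, Fin (N i)) * C) with hD
  have hDtop : D ≠ ⊤ :=
    ENNReal.mul_ne_top hk₁top (ENNReal.mul_ne_top (ENNReal.natCast_ne_top _) ENNReal.coe_ne_top)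
  have hD'top : D ^ (1 / p) ≠ ⊤ := ENNReal.rpow_ne_top_of_nonneg (by positivity) hDtop
  refine ⟨(D ^ (1 / p)).toNNReal, fun S hS hSA hSlam hT R hR f hf => ?_⟩
  rw [ENNReal.coe_toNNReal hD'top]
  have hSm : ∀ i, AEStronglyMeasurable (S i) (volume.restrict (U i)) := fun i =>
    ((hS i).continuousOn.mono (subset_closure.trans (hUV i))).aestronglyMeasurable
      (hUo i).measurableSet
  have hfi : ∀ i, IntegrableOn (f i) (U i) := fun i => by
    have : IsFiniteMeasure (volume.restrict (U i)) :=
      isFiniteMeasure_restrict.2 (hUb i).measure_lt_top.ne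
    exact (hf i).integrable one_le_two
  have hZsub : ∀ i k, Z i k ⊆ U i := fun i k => hZU i ▸ subset_iUnion (Z i) k
  have hcont : ∀ i k, Continuous (extensionOp (Z i k) (S i) (f i)) := fun i k =>
    continuous_extensionOp ((hSm i).mono_measure (Measure.restrict_mono (hZsub i k) le_rfl))
      ((hfi i).mono_set (hZsub i k))
  have hpiece : ∀ τ : ∀ i, Fin (N i), ∫⁻ x in Metric.ball 0 R,
      ∏ i, ‖extensionOp (Z i (τ i)) (S i) (f i) x‖ₑ ^ p ≤
        C * ENNReal.ofReal (R ^ (p * ε)) * ∏ i, eLpNorm (f i) 2 (volume.restrict (U i)) ^ p := by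
    intro τ
    refine (hC S V (fun i => q i (τ i)) (fun i => Z i (τ i)) hVo
      (fun i => hρV i _ (hqZ i _).1) hS (fun i m hm ξ hξ => (hSA i m hm ξ hξ).trans (le_max_left _ _))
      (fun i => hSlam i _ (hqZ i _).1) (fun N hN => hT _ N (fun i => (hqZ i _).1) hN)
      (fun i => hZm i _) (fun i => (hqZ i _).2)
      (fun i => (hZsub i _).trans ((subset_iUnion U i).trans hr)) R hR f
      fun i => (hf i).mono_measure (Measure.restrict_mono (hZsub i _) le_rfl)).trans ?_
    gcongr with i
    exact hZsub i _
  have hint : ∫⁻ x in Metric.ball 0 R, ‖∏ i, extensionOp (U i) (S i) (f i) x‖ₑ ^ p ≤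
      D * ENNReal.ofReal (R ^ (p * ε)) * ∏ i, eLpNorm (f i) 2 (volume.restrict (U i)) ^ p :=
    calc _ ≤ ∫⁻ x in Metric.ball 0 R, k₁ * ∑ τ : ∀ i, Fin (N i),
            ∏ i, ‖extensionOp (Z i (τ i)) (S i) (f i) x‖ₑ ^ p := by
          refine lintegral_mono fun x => ?_
          have h1 := ENNReal.prod_sum_rpow_le
            (fun i (k : Fin (N i)) => ‖extensionOp (Z i k) (S i) (f i) x‖ₑ) hp0 (N := M)
            (fun i => by
              rw [Fintype.card_fin]
              exact Finset.single_le_sum (fun _ _ => Nat.zero_le _) (Finset.mem_univ i))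
          rw [Fintype.card_fin] at h1
          refine le_trans ?_ h1
          rw [← ofReal_norm, norm_prod, ENNReal.ofReal_prod_of_nonneg fun i _ => norm_nonneg _,
            ← ENNReal.prod_rpow_of_nonneg hp0.le]
          gcongr with i
          rw [ofReal_norm, extensionOp_iUnion (hZm i) (hZd i) (hZU i) (hSm i) (hfi i) x]
          exact enorm_sum_le _ _
      _ = k₁ * ∑ τ : ∀ i, Fin (N i), ∫⁻ x in Metric.ball 0 R,
            ∏ i, ‖extensionOp (Z i (τ i)) (S i) (f i) x‖ₑ ^ p := by
          rw [lintegral_const_mul' _ _ hk₁top, lintegral_finsetSum]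
          exact fun τ _ => Finset.measurable_prod _ fun i _ =>
            (hcont i (τ i)).enorm.measurable.pow_const _
      _ ≤ k₁ * ∑ τ : ∀ i, Fin (N i), (C * ENNReal.ofReal (R ^ (p * ε)) *
            ∏ i, eLpNorm (f i) 2 (volume.restrict (U i)) ^ p) := by
          gcongr with τ
          exact hpiece τ
      _ = _ := by
          rw [Finset.sum_const, Finset.card_univ, nsmul_eq_mul, hD]
          ring
  have hR0 : 0 ≤ R := by linarith
  rw [eLpNorm_eq_lintegral_rpow_enorm_toReal (ENNReal.ofReal_pos.2 hp0).ne' ENNReal.ofReal_ne_top,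
    ENNReal.toReal_ofReal hp0.le]
  refine (ENNReal.rpow_le_rpow hint (by positivity)).trans_eq ?_
  rw [ENNReal.prod_rpow_of_nonneg hp0.le, ENNReal.mul_rpow_of_nonneg _ _ (by positivity),
    ENNReal.mul_rpow_of_nonneg _ _ (by positivity), ← ENNReal.rpow_mul, mul_one_div_cancel hp0.ne',
    ENNReal.rpow_one, ENNReal.ofReal_rpow_of_nonneg (by positivity) (by positivity),
    ← Real.rpow_mul hR0, mul_right_comm p, mul_one_div_cancel hp0.ne', one_mul]

end MainTheorem
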